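/- Let $\Omega\subset\mathbb R^2$ be a bounded open set and let $\mu$ be a finite signed Radon measure on $\Omega$. A \emph{stationary system of point vortices} in $\Omega$ consists of finitely many distinct points $z_1,\dots,z_N\in\Omega$ and integers $d_1,\dots,d_N\in\mathbb Z$ such that $$\sum_{j\neq i} d_j\,\frac{z_i-z_j}{|z_i-z_j|^2}=0\qquad\text{for all } i=1,\dots,N .$$ Assume that for every $\varepsilon>0$ there are a stationary system of point vortices $(z_i^\varepsilon,d_i^\varepsilon)_{1\le i\le N^\varepsilon}$ in $\Omega$ and a renormalization constant $c_\varepsilon>0$ (for instance $c_\varepsilon=1$, or $c_\varepsilon=1/\sum_i|d_i^\varepsilon|$ if this sum is not $0$) such that $$\Big\|\mu-2\pi c_\varepsilon\sum_{i=1}^{N^\varepsilon}d_i^\varepsilon\,\delta_{z_i^\varepsilon}\Big\|_{(C^0(\Omega))^*}<\varepsilon ,$$ where $C^0(\Omega)$ is the space of bounded continuous functions on $\Omega$ with the supremum norm. Then there is a function $u\in L^1_{loc}(\Omega)$, with weak gradient $\nabla u\in L^1_{loc}(\Omega)$, such that: 1) $\Delta u=\mu$ in $\Omega$ in the sense of distributions;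 2) the tensor $$T_u=\begin{pmatrix}\frac12\left[(\partial_yu)^2-(\partial_xu)^2\right] & -\partial_xu\,\partial_yu\\ -\partial_xu\,\partial_yu & \frac12\left[(\partial_xu)^2-(\partial_yu)^2\right]\end{pmatrix}$$ is divergence-free in finite part in $\Omega$; 3) if moreover $\mu\in H^{-1}(\Omega)$, the dual of $H^1_0(\Omega)$, then $u\in H^1(\Omega)$ and $\operatorname{div}T_u=0$ in $\Omega$ in the sense of distributions (row by row), i.e. $u$ is stationary harmonic. Here a tensor is divergence-free in finite part if each of its rows is, and a vector field $X$ on $\Omega$ is \emph{divergence-free in finite part} if there is a family $(E_\delta)_{\delta>0}$ of Borel subsets of $\Omega$ such that: for every compact $K\subset\Omega$, $\lim_{\delta\to0}\operatorname{cap}_1(K\cap E_\delta)=0$; for every $\delta>0$, $X\in L^1(\Omega\setminus E_\delta)$; and for every $\delta>0$ and every $\zeta\in C_c^\infty(\Omega)$, $\int_{\Omega\setminus F_\delta}X\cdot\nabla\zeta=0$, where $F_\delta=\zeta^{-1}(\zeta(E_\delta))$. The $1$-capacity of $A\subset\mathbb R^2$ is $$\operatorname{cap}_1(A)=\inf\Big\{\int_{\mathbb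 R^2}|\nabla\varphi| \;:\; \varphi\in L^2(\mathbb R^2),\ \nabla\varphi\in L^1(\mathbb R^2),\ A\subset\operatorname{int}\{\varphi\ge1\}\Big\}.$$ -/

import Mathlib

open MeasureTheory TopologicalSpace Set Filter Topology
open scoped ENNReal BoundedContinuousFunction Distributions

noncomputable section

namespace PointVortex

/-- The Euclidean plane `ℝ²`. -/
abbrev Plane : Type := EuclideanSpace ℝ (Fin 2)

/-! ### Weak derivatives, `H¹`, `H⁻¹` -/

/-- `g` is the weak (distributional) gradient of `u` in the open set `Ω`, both being in
`L¹_loc(Ω)`. -/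
structure HasWeakGradient (Ω : Opens Plane) (u : Plane → ℝ) (g : Plane → Plane) : Prop where
  locallyIntegrableOn : LocallyIntegrableOn u Ω volume
  locallyIntegrableOn_grad : LocallyIntegrableOn g Ω volume
  integral_eq : ∀ φ : 𝓓(Ω, ℝ),
    ∫ x in (Ω : Set Plane), u x • gradient φ x = -∫ x in (Ω : Set Plane), φ x • g x

/-- `u ∈ H¹(Ω)`, with weak gradient `g`. -/
structure IsH1With (Ω : Opens Plane) (u : Plane → ℝ) (g : Plane → Plane) : Prop where
  memLp : MemLp u 2 (volume.restrict (Ω : Set Plane))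
  memLp_grad : MemLp g 2 (volume.restrict (Ω : Set Plane))
  hasWeakGradient : HasWeakGradient Ω u g

/-- `u ∈ H¹(Ω)`. -/
def IsH1 (Ω : Opens Plane) (u : Plane → ℝ) : Prop :=
  ∃ g : Plane → Plane, IsH1With Ω u g

/-- The `H¹` norm of a test function. -/
def testH1Norm {Ω : Opens Plane} (φ : 𝓓(Ω, ℝ)) : ℝ :=
  Real.sqrt ((∫ x, φ x ^ 2) + ∫ x, ‖gradient φ x‖ ^ 2)

/-- The signed measure `μ` on `Ω` belongs to `H⁻¹(Ω)`, the dual of `H¹₀(Ω)`: the functional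
`φ ↦ ∫ φ dμ` on `C_c^∞(Ω)` is bounded for the `H¹` norm. (Test functions are dense in `H¹₀(Ω)`, so
that it has then a unique bounded extension to `H¹₀(Ω)`.) -/
def IsHMinusOne (Ω : Opens Plane) (μ : SignedMeasure Ω) : Prop :=
  ∃ C : ℝ, ∀ φ : 𝓓(Ω, ℝ), |∫ᵛ x : Ω, φ (x : Plane) ∂•μ| ≤ C * testH1Norm φ

/-- `Δ u = μ` in `Ω`, in the sense of distributions. -/
def HasWeakLaplacian (Ω : Opens Plane) (u : Plane → ℝ) (μ : SignedMeasure Ω) : Prop :=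
  ∀ φ : 𝓓(Ω, ℝ),
    ∫ x in (Ω : Set Plane), u x * Laplacian.laplacian (φ : Plane → ℝ) x
      = ∫ᵛ x : Ω, φ (x : Plane) ∂•μ

/-! ### The stress-energy tensor -/

/-- The stress-energy tensor of the Dirichlet energy, as a function of the gradient `g`. -/
def stressEnergy (g : Plane) : Matrix (Fin 2) (Fin 2) ℝ :=
  !![(1 / 2) * (g 1 ^ 2 - g 0 ^ 2), -(g 0 * g 1);
     -(g 0 * g 1), (1 / 2) * (g 0 ^ 2 - g 1 ^ 2)]

/-- The `i`-th row `(T_{i1}, T_{i2})` of a 2-tensor, as a vector field. -/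
def tensorRow (T : Plane → Matrix (Fin 2) (Fin 2) ℝ) (i : Fin 2) (x : Plane) : Plane :=
  WithLp.toLp 2 (T x i)

/-- The tensor `T` is divergence-free in `Ω` in the sense of distributions (row by row). -/
def IsDivFree (Ω : Opens Plane) (T : Plane → Matrix (Fin 2) (Fin 2) ℝ) : Prop :=
  ∀ i : Fin 2, LocallyIntegrableOn (tensorRow T i) Ω volume ∧
    ∀ ζ : 𝓓(Ω, ℝ), ∫ x in (Ω : Set Plane), inner ℝ (tensorRow T i x) (gradient ζ x) = 0

/-- `u` is stationary harmonic in `Ω`: it is in `H¹(Ω)` and its stress-energy tensor is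
divergence-free in the sense of distributions. -/
def IsStationaryHarmonic (Ω : Opens Plane) (u : Plane → ℝ) : Prop :=
  ∃ g : Plane → Plane, IsH1With Ω u g ∧ IsDivFree Ω (fun x => stressEnergy (g x))

/-! ### Capacity and divergence-free fields in finite part -/

/-- The `1`-capacity of a subset of the plane: the infimum of `∫ |∇φ|` over `φ ∈ L²(ℝ²)` with weak
gradient `∇φ ∈ L¹(ℝ²)` and `A` contained in the interior of `{φ ≥ 1}`. -/
def oneCapacity (A : Set Plane) : ℝ≥0∞ :=
  ⨅ (φ : Plane → ℝ) (g : Plane → Plane) (_ : MemLp φ 2 volume) (_ : Integrable g volume)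
    (_ : HasWeakGradient ⊤ φ g) (_ : A ⊆ interior {x | 1 ≤ φ x}), ∫⁻ x, ‖g x‖ₑ

/-- The vector field `X` is divergence-free in finite part in `Ω`. -/
def IsDivFreeFP (Ω : Opens Plane) (X : Plane → Plane) : Prop :=
  ∃ E : ℝ → Set Plane,
    (∀ δ > 0, MeasurableSet (E δ) ∧ E δ ⊆ Ω) ∧
    (∀ K : Set Plane, IsCompact K → K ⊆ Ω →
      Tendsto (fun δ => oneCapacity (K ∩ E δ)) (𝓝[>] (0 : ℝ)) (𝓝 0)) ∧
    (∀ δ > 0, IntegrableOn X (Ω \ E δ) volume) ∧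
    (∀ δ > 0, ∀ ζ : 𝓓(Ω, ℝ),
      ∫ x in (Ω : Set Plane) \ (ζ ⁻¹' (ζ '' E δ)), inner ℝ (X x) (gradient ζ x) = 0)

/-- A 2-tensor is divergence-free in finite part if its rows are. -/
def IsTensorDivFreeFP (Ω : Opens Plane) (T : Plane → Matrix (Fin 2) (Fin 2) ℝ) : Prop :=
  ∀ i : Fin 2, IsDivFreeFP Ω (tensorRow T i)

/-- `u` has a weak gradient in `Ω`, and its stress-energy tensor `T_u` is divergence-free in finite
part in `Ω`. -/
def IsWeaklyStationaryHarmonic (Ω : Opens Plane) (u : Plane → ℝ) : Prop :=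
  ∃ g : Plane → Plane, HasWeakGradient Ω u g ∧ IsTensorDivFreeFP Ω (fun x => stressEnergy (g x))

/-! ### Systems of point vortices -/

/-- The distinct points `z i`, with degrees `d i`, form a stationary system of point vortices. -/
def IsStationaryVortexSystem {N : ℕ} (z : Fin N → Plane) (d : Fin N → ℤ) : Prop :=
  Function.Injective z ∧
    ∀ i, ∑ j ∈ Finset.univ.erase i, ((d j : ℝ) / ‖z i - z j‖ ^ 2) • (z i - z j) = 0

/-- The vorticity `2π ∑ dᵢ δ_{zᵢ}` of a system of point vortices in `Ω`. -/
def vorticity {Ω : Opens Plane} {N : ℕ} (z : Fin N → Ω) (d : Fin N → ℤ) : SignedMeasure Ω :=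
  (2 * Real.pi) • ∑ i, (d i : ℝ) • (Measure.dirac (z i)).toSignedMeasure

/-- The norm of a finite signed measure on `Ω` as an element of the dual of `C⁰(Ω)` (bounded
continuous functions with the sup norm). -/
def dualC0Norm {Ω : Opens Plane} (α : SignedMeasure Ω) : ℝ≥0∞ :=
  ⨆ (f : Ω →ᵇ ℝ) (_ : ‖f‖ ≤ 1), ‖∫ᵛ x, f x ∂•α‖ₑ

/-- `μ` is a limit in `(C⁰(Ω))*` of renormalized vorticities `c · 2π ∑ dᵢ δ_{zᵢ}`, `c > 0`, of
stationary systems of point vortices in `Ω`. -/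
def IsLimitOfStationaryVortices {Ω : Opens Plane} (μ : SignedMeasure Ω) : Prop :=
  ∀ ε : ℝ≥0∞, 0 < ε → ∃ (N : ℕ) (z : Fin N → Ω) (d : Fin N → ℤ) (c : ℝ), 0 < c ∧
    IsStationaryVortexSystem (fun i => (z i : Plane)) d ∧
    dualC0Norm (μ - c • vorticity z d) < ε

end PointVortex

end

open MeasureTheory TopologicalSpace Set Filter Topology
open scoped ENNReal BoundedContinuousFunction Distributions

noncomputable section

namespace PointVortex

/-! Tested against bounded continuous functions, a finite combination of Dirac masses has norm at
least the `ℓ¹` norm of its weights. Indexed by the countable set `S` of all vortices of a sequence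
of approximations, the weights `α n` are therefore Cauchy in `ℓ¹`, and `μ = 2π ∑ a s δ_s` with
summable `a` (`IsLimitOfStationaryVortices.exists_weights`). The function sought is `u = ∑ a s log
|x - s|`, whose distributional Laplacian is `μ`.

In complex notation the conjugate of `∇u` is `∑ a s / (x - s)`, and the rows of `T_u` are linear in
its square, the Hopf differential. For a stationary system the cross terms of this square regroup by
partial fractions into simple poles whose coefficients contain exactly the sums that stationarity
annihilates, so only double poles remain (`sq_sum_div_eq`). The identity is stable under `ℓ¹`
convergence at almost every `x` (`ae_sq_tsum_eq`). Hence `T_u` is a superposition of the fields of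
`(a s)² / (x - s)²`, each of them a rotated gradient away from `s`.

These fields are not integrable near `s`. The discs of radius `δ |a s|` are removed: their union has
`1`-capacity `O(δ ∑ |a s|)` (`exists_oneCapacity_iUnion_ball_le`), and outside them `(a s)² / |x -
s|² ≤ δ⁻¹ |a s| / |x - s|`, which is summable in `L¹` (`integrableOn_smul_rowField`). The flux of a
rotated gradient against `∇ζ` over `ζ⁻¹(D)` vanishes for Borel `D`, because `f(ζ) ∇ζ` is a gradient
for every continuous `f`; and `ζ⁻¹(ζ(E_δ))` contains a neighbourhood of each charged vortex, so the
singularities play no part (`setIntegral_inner_rowField_eq_zero`).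

Finally, points have zero `H¹`-capacity in the plane, so an atomic measure in `H⁻¹` has no atoms
(`IsHMinusOne.weights_eq_zero`). Under the extra assumption of the last claim, `a = 0` and `u = 0`.
-/

/-! ### Identification of the plane with `ℂ`. -/

/-- The plane as the complex line. -/
def toC (v : Plane) : ℂ := ⟨v 0, v 1⟩

theorem toC_sub (v w : Plane) : toC (v - w) = toC v - toC w := by
  apply Complex.ext <;> simp [toC]

theorem toC_smul (r : ℝ) (v : Plane) : toC (r • v) = r * toC v := by
  apply Complex.ext <;> simp [toC]

theorem toC_injective : Function.Injective toC := by
  intro v w h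
  have h0 := congrArg Complex.re h
  have h1 := congrArg Complex.im h
  ext i
  fin_cases i
  · exact h0
  · exact h1

theorem norm_sq_eq (v : Plane) : ‖v‖ ^ 2 = v 0 ^ 2 + v 1 ^ 2 := by
  rw [EuclideanSpace.norm_sq_eq]
  simp [Fin.sum_univ_two]

theorem normSq_toC (v : Plane) : Complex.normSq (toC v) = ‖v‖ ^ 2 := by
  rw [norm_sq_eq, Complex.normSq_apply]
  simp [toC, sq]

theorem norm_toC (v : Plane) : ‖toC v‖ = ‖v‖ := by
  rw [← Real.sqrt_sq (norm_nonneg v), ← normSq_toC]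
  rfl

theorem measurable_toC : Measurable toC :=
  Measurable.comp (g := fun p : ℝ × ℝ => Complex.measurableEquivRealProd.symm p)
    (f := fun v : Plane => (v 0, v 1)) Complex.measurableEquivRealProd.symm.measurable
    (by fun_prop)

/-! ### The Hopf differential of a stationary system has only double poles. -/

/-- The expansion of the square of a rational function with simple poles without regular part at the
poles. -/
theorem sq_sum_div_eq {ι : Type*} [Fintype ι] {z w : ι → ℂ} (hz : Function.Injective z)
    (h : ∀ i, ∑ j, w j / (z i - z j) = 0) {x : ℂ} (hx : ∀ i, x ≠ z i) :
    (∑ i, w i / (x - z i)) ^ 2 = ∑ i, w i ^ 2 / (x - z i) ^ 2 := by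
  classical
  -- Partial fractions of a product of two simple poles. On the diagonal the bracket is zero because
  -- division by `z i - z i = 0` gives `0`; the same convention lets `h` sum over all `j`.
  have key : ∀ i j, w i / (x - z i) * (w j / (x - z j)) =
      (if i = j then w i ^ 2 / (x - z i) ^ 2 else 0) +
      (w i / (x - z i) * (w j / (z i - z j)) + w j / (x - z j) * (w i / (z j - z i))) := by
    intro i j
    have hi : x - z i ≠ 0 := sub_ne_zero.2 (hx i)
    have hj : x - z j ≠ 0 := sub_ne_zero.2 (hx j)
    split_ifs with hij
    · subst hij
      simp only [sub_self, div_zero, mul_zero, add_zero]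
      rw [div_mul_div_comm, ← sq, ← sq]
    · have hij' : z i - z j ≠ 0 := sub_ne_zero.2 fun e => hij (hz e)
      have hji' : z j - z i ≠ 0 := sub_ne_zero.2 fun e => hij (hz e.symm)
      field_simp
      ring
  have h1 : ∑ i, ∑ j, w i / (x - z i) * (w j / (z i - z j)) = 0 := by
    simp_rw [← Finset.mul_sum, h]
    simp
  have h2 : ∑ i, ∑ j, w j / (x - z j) * (w i / (z j - z i)) = 0 := by
    rw [Finset.sum_comm]
    exact h1
  rw [sq, Finset.sum_mul_sum]
  simp_rw [key, Finset.sum_add_distrib, h1, h2]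
  simp

/-- The conjugate of `v / |v|²` is `1 / v`, so this is the conjugated equilibrium equation. The
added term `j = i` is a division by zero, hence `0`. -/
theorem IsStationaryVortexSystem.sum_div_eq_zero {N : ℕ} {z : Fin N → Plane} {d : Fin N → ℤ}
    (h : IsStationaryVortexSystem z d) (i : Fin N) :
    ∑ j, (d j : ℂ) / (toC (z i) - toC (z j)) = 0 := by
  have h1 := h.2 i
  rw [Finset.sum_erase _ (by simp)] at h1
  have key : ∀ j, (d j : ℂ) / (toC (z i) - toC (z j)) =
      (starRingEnd ℂ) (toC (((d j : ℝ) / ‖z i - z j‖ ^ 2) • (z i - z j))) := by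
    intro j
    rw [← toC_sub, div_eq_mul_inv, Complex.inv_def, normSq_toC]
    rw [toC_smul, map_mul, Complex.conj_ofReal]
    push_cast
    ring
  simp_rw [key]
  rw [← map_sum]
  have h2 : ∑ j, toC (((d j : ℝ) / ‖z i - z j‖ ^ 2) • (z i - z j)) = 0 := by
    have h3 : ∀ k : Fin 2, ∑ j, ((((d j : ℝ) / ‖z i - z j‖ ^ 2) • (z i - z j)) : Plane) k = 0 := by
      intro k
      have := congrArg (fun v : Plane => v k) h1
      simpa using this
    apply Complex.ext
    · rw [Complex.re_sum]
      exact h3 0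
    · rw [Complex.im_sum]
      exact h3 1
  rw [h2, map_zero]

/-! ### The limit measure is atomic with summable weights. -/

theorem integrable_boundedContinuousFunction {Ω : Opens Plane} (μ : SignedMeasure Ω)
    (f : Ω →ᵇ ℝ) : μ.Integrable f := by
  have : IsFiniteMeasure μ.variation := by
    rw [← SignedMeasure.totalVariation_eq_variation]
    infer_instance
  exact f.integrable _

theorem integral_smul_vorticity {Ω : Opens Plane} {N : ℕ} (z : Fin N → Ω) (d : Fin N → ℤ) (c : ℝ)
    (f : Ω →ᵇ ℝ) :
    ∫ᵛ x, f x ∂•(c • vorticity z d) = 2 * Real.pi * ∑ i, c * d i * f (z i) := by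
  have h1 : ∀ i, ∫ᵛ x, f x ∂•((d i : ℝ) • (Measure.dirac (z i)).toSignedMeasure)
      = d i * f (z i) := by
    intro i
    rw [VectorMeasure.integral_smul_vectorMeasure]
    have : ∫ᵛ x, f x ∂•(Measure.dirac (z i)).toSignedMeasure = f (z i) := by
      have h2 := VectorMeasure.integral_toSignedMeasure (μ := Measure.dirac (z i)) (f := f)
      rw [integral_dirac] at h2
      rw [← h2]
      congr 1
      ext
      simp
    rw [this, smul_eq_mul]
  rw [vorticity, VectorMeasure.integral_smul_vectorMeasure,
    VectorMeasure.integral_smul_vectorMeasure, VectorMeasure.integral_finsetSum_vectorMeasure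
      (fun i _ => integrable_boundedContinuousFunction _ f)]
  simp_rw [h1, smul_eq_mul, Finset.mul_sum]
  refine Finset.sum_congr rfl fun i _ => ?_
  ring

theorem abs_integral_sub_le {Ω : Opens Plane} {μ : SignedMeasure Ω} {N : ℕ} {z : Fin N → Ω}
    {d : Fin N → ℤ} {c ε : ℝ} (hε : 0 ≤ ε)
    (h : dualC0Norm (μ - c • vorticity z d) ≤ ENNReal.ofReal ε) {f : Ω →ᵇ ℝ} (hf : ‖f‖ ≤ 1) :
    |∫ᵛ x, f x ∂•μ - 2 * Real.pi * ∑ i, c * d i * f (z i)| ≤ ε := by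
  rw [← integral_smul_vorticity, ← VectorMeasure.integral_sub_vectorMeasure
    (integrable_boundedContinuousFunction _ f) (integrable_boundedContinuousFunction _ f)]
  have h1 : ‖∫ᵛ x, f x ∂•(μ - c • vorticity z d)‖ₑ ≤ ENNReal.ofReal ε :=
    le_trans (le_iSup₂ (f := fun (f : Ω →ᵇ ℝ) (_ : ‖f‖ ≤ 1) =>
      ‖∫ᵛ x, f x ∂•(μ - c • vorticity z d)‖ₑ) f hf) h
  rw [← ofReal_norm, ENNReal.ofReal_le_ofReal_iff hε] at h1
  exact h1

/-- The `ℓ¹` norm of a finite combination of Dirac masses is at most its norm as a functional on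
bounded continuous functions. -/
theorem tsum_abs_le_of_forall_abs_tsum_le {X : Type*} [TopologicalSpace X] [NormalSpace X]
    [T1Space X] {S : Set X} {β : S → ℝ} (hβ : (Function.support β).Finite) {C : ℝ}
    (h : ∀ f : X →ᵇ ℝ, ‖f‖ ≤ 1 → |∑' s, β s * f s| ≤ C) : ∑' s, |β s| ≤ C := by
  classical
  let T : Set X := Subtype.val '' Function.support β
  have hT : T.Finite := hβ.image _
  have : Finite T := hT
  have : DiscreteTopology T := Finite.instDiscreteTopology
  let g : T →ᵇ ℝ := BoundedContinuousFunction.ofNormedAddCommGroup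
    (fun t => if h : (t : X) ∈ S then SignType.sign (β ⟨t, h⟩) else (0 : ℝ))
    continuous_of_discreteTopology 1 (by
      intro t
      split_ifs with ht
      · rcases lt_trichotomy (β ⟨t, ht⟩) 0 with h0 | h0 | h0 <;> simp [h0]
      · simp)
  -- Tietze extension without increase of the norm: `f` equals the sign of `β` on its finite, hence
  -- closed and discrete, support.
  obtain ⟨f, hf1, hf2⟩ := BoundedContinuousFunction.exists_extension_norm_eq_of_isClosedEmbedding g
    (hT.isClosed.isClosedEmbedding_subtypeVal)
  have hf3 : ‖f‖ ≤ 1 := by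
    rw [hf1]
    refine (BoundedContinuousFunction.norm_le zero_le_one).2 fun t => ?_
    change ‖(if h : (t : X) ∈ S then (SignType.sign (β ⟨t, h⟩) : ℝ) else (0 : ℝ))‖ ≤ 1
    split_ifs with ht
    · rcases lt_trichotomy (β ⟨t, ht⟩) 0 with h0 | h0 | h0 <;> simp [h0]
    · simp
  have h4 : ∀ s, β s * f s = |β s| := by
    intro s
    by_cases hs : β s = 0
    · simp [hs]
    · have h5 : f s = g ⟨s, s, hs, rfl⟩ := congrFun hf2 ⟨s, s, hs, rfl⟩
      have h6 : g ⟨s, s, hs, rfl⟩ = SignType.sign (β s) := by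
        change (if h : (s : X) ∈ S then (SignType.sign (β ⟨s, h⟩) : ℝ) else (0 : ℝ)) = _
        rw [dif_pos s.2]
      rw [h5, h6, self_mul_sign]
  have h7 := h f hf3
  simp_rw [h4] at h7
  exact (le_abs_self _).trans h7

/-- Transfers finite sums over the vortices of one system to sums over the index set `S` common to
all systems. It serves linear and quadratic expressions in the weights alike, whence the general
`G`. -/
theorem tsum_extend_apply {ι κ R M : Type*} [Fintype ι] [Zero R] [AddCommMonoid M]
    [TopologicalSpace M] {z : ι → κ} (hz : Function.Injective z) (w : ι → R) (G : κ → R → M)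
    (hG : ∀ s, G s 0 = 0) :
    ∑' s, G s (Function.extend z w 0 s) = ∑ i, G (z i) (w i) := by
  have : (fun s => G s (Function.extend z w 0 s)) =
      Function.extend z (fun i => G (z i) (w i)) 0 := by
    funext s
    by_cases hs : ∃ i, z i = s
    · obtain ⟨i, rfl⟩ := hs
      rw [hz.extend_apply, hz.extend_apply]
    · rw [Function.extend_apply' _ _ _ hs, Function.extend_apply' _ _ _ hs]
      exact hG s
  rw [this, tsum_extend_zero hz, tsum_fintype]

theorem memlp_one_iff_summable_abs {ι : Type*} {a : ι → ℝ} :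
    Memℓp a 1 ↔ Summable fun s => |a s| := by
  rw [memℓp_gen_iff (by simp)]
  simp

theorem lp_one_norm_eq {ι : Type*} (a : lp (fun _ : ι => ℝ) 1) : ‖a‖ = ∑' s, |a s| := by
  rw [lp.norm_eq_tsum_rpow (by simp)]
  simp

/-- A sequence which is summably Cauchy in `ℓ¹`, with errors `ε n`, has a limit. -/
theorem exists_l1_limit {ι : Type*} {α : ℕ → ι → ℝ} {ε : ℕ → ℝ} (hε : Tendsto ε atTop (𝓝 0))
    (hα : ∀ n, Summable fun s => |α n s|)
    (h : ∀ n m, ∑' s, |α n s - α m s| ≤ ε n + ε m) :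
    ∃ a : ι → ℝ, (Summable fun s => |a s|) ∧ ∀ n, ∑' s, |α n s - a s| ≤ ε n := by
  let A : ℕ → lp (fun _ : ι => ℝ) 1 := fun n => ⟨α n, memlp_one_iff_summable_abs.2 (hα n)⟩
  have hA : ∀ n m, ‖A n - A m‖ ≤ ε n + ε m := fun n m => by
    rw [lp_one_norm_eq]
    exact h n m
  have hC : CauchySeq A := by
    rw [Metric.cauchySeq_iff]
    intro r hr
    obtain ⟨M, hM⟩ := (hε.eventually (gt_mem_nhds (half_pos hr))).exists_forall_of_atTop
    refine ⟨M, fun m hm n hn => ?_⟩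
    rw [dist_eq_norm]
    linarith [hA m n, hM m hm, hM n hn]
  obtain ⟨a, ha⟩ := cauchySeq_tendsto_of_complete hC
  refine ⟨a, memlp_one_iff_summable_abs.1 a.2, fun n => ?_⟩
  have h1 : Tendsto (fun m => ‖A n - A m‖) atTop (𝓝 ‖A n - a‖) := (tendsto_const_nhds.sub ha).norm
  have h2 : Tendsto (fun m => ε n + ε m) atTop (𝓝 (ε n + 0)) := tendsto_const_nhds.add hε
  have h3 := le_of_tendsto_of_tendsto' h1 h2 (hA n)
  rw [lp_one_norm_eq, add_zero] at h3
  exact h3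

/-- A limit of vorticities of stationary systems is atomic, with weights which are limits in `ℓ¹`
of finitely supported weights for which the Hopf differential has no simple poles. -/
theorem IsLimitOfStationaryVortices.exists_weights {Ω : Opens Plane} {μ : SignedMeasure Ω}
    (hμ : IsLimitOfStationaryVortices μ) :
    ∃ (S : Set Ω) (α : ℕ → S → ℝ) (a : S → ℝ), S.Countable ∧ (Summable fun s => |a s|) ∧
      (∀ n, (Function.support (α n)).Finite) ∧
      (∀ n, ∑' s, |α n s - a s| ≤ (1 / 4) ^ n) ∧
      (∀ n (x : Plane), (∀ s : S, x ≠ s) →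
        (∑' s : S, (α n s : ℂ) / (toC x - toC s)) ^ 2 =
          ∑' s : S, (α n s : ℂ) ^ 2 / (toC x - toC s) ^ 2) ∧
      ∀ f : Ω →ᵇ ℝ, ∫ᵛ x, f x ∂•μ = 2 * Real.pi * ∑' s : S, a s * f s := by
  -- The geometric rate matters beyond convergence: summability in `n` of the errors later gives
  -- almost everywhere convergence without extracting a subsequence.
  have hex : ∀ n : ℕ, ∃ (N : ℕ) (z : Fin N → Ω) (d : Fin N → ℤ) (c : ℝ), 0 < c ∧
      IsStationaryVortexSystem (fun i => (z i : Plane)) d ∧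
      dualC0Norm (μ - c • vorticity z d) < ENNReal.ofReal ((1 / 4) ^ n) :=
    fun n => hμ _ (by positivity)
  choose N z d c hc hst hle using hex
  let S : Set Ω := ⋃ n, range (z n)
  let zS : ∀ n, Fin (N n) → S := fun n i => ⟨z n i, mem_iUnion.2 ⟨n, i, rfl⟩⟩
  have hzS : ∀ n, Function.Injective (zS n) := fun n i j hij =>
    (hst n).1 (congrArg (fun s : S => ((s : Ω) : Plane)) hij)
  let α : ℕ → S → ℝ := fun n => Function.extend (zS n) (fun i => c n * d n i) 0
  have hsupp : ∀ n, (Function.support (α n)).Finite := fun n => by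
    refine (finite_range (zS n)).subset fun s hs => ?_
    by_contra hcon
    exact hs (Function.extend_apply' _ _ _ hcon)
  have happ : ∀ n (f : Ω →ᵇ ℝ), ∑ i, c n * d n i * f (z n i) = ∑' s, α n s * f s := fun n f =>
    (tsum_extend_apply (hzS n) (fun i => c n * (d n i : ℝ)) (fun s r => r * f s)
      (fun s => zero_mul _)).symm
  have hclose : ∀ n (f : Ω →ᵇ ℝ), ‖f‖ ≤ 1 →
      |∫ᵛ x, f x ∂•μ - 2 * Real.pi * ∑' s, α n s * f s| ≤ (1 / 4) ^ n := fun n f hf => by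
    rw [← happ]
    exact abs_integral_sub_le (by positivity) (hle n).le hf
  have hα : ∀ n, Summable fun s => |α n s| := fun n =>
    summable_of_hasFiniteSupport ((hsupp n).subset fun s hs => by
      simpa using hs)
  have hαf : ∀ n (f : Ω →ᵇ ℝ), Summable fun s => α n s * f s := fun n f =>
    summable_of_hasFiniteSupport ((hsupp n).subset fun s hs => by
      simpa using left_ne_zero_of_mul hs)
  have hε : Tendsto (fun n : ℕ => (1 / 4 : ℝ) ^ n) atTop (𝓝 0) :=
    tendsto_pow_atTop_nhds_zero_of_lt_one (by norm_num) (by norm_num)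
  have hcauchy : ∀ n m, ∑' s, |α n s - α m s| ≤ (1 / 4) ^ n + (1 / 4) ^ m := fun n m => by
    refine tsum_abs_le_of_forall_abs_tsum_le (β := fun s => α n s - α m s)
      (((hsupp n).union (hsupp m)).subset fun s hs => ?_) fun f hf => ?_
    · by_contra hcon
      simp only [mem_union, Function.mem_support, not_or, not_not] at hcon
      exact hs (by simp [hcon.1, hcon.2])
    · have h1 := hclose n f hf
      have h2 := hclose m f hf
      simp_rw [sub_mul]
      rw [(hαf n f).tsum_sub (hαf m f)]
      have h3 : |2 * Real.pi * (∑' s, α n s * f s - ∑' s, α m s * f s)| ≤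
          (1 / 4) ^ n + (1 / 4) ^ m := by
        rw [abs_le] at *
        constructor <;> linarith
      rw [abs_mul, abs_of_pos Real.two_pi_pos] at h3
      -- The factor `2π` is dropped since it exceeds `1`.
      nlinarith [Real.pi_gt_three, abs_nonneg (∑' s, α n s * f s - ∑' s, α m s * f s)]
  obtain ⟨a, ha, hαa⟩ := exists_l1_limit hε hα hcauchy
  refine ⟨S, α, a, countable_iUnion fun n => countable_range _, ha, hsupp, hαa, ?_, ?_⟩
  · intro n x hx
    have h1 := sq_sum_div_eq (z := fun i => toC (z n i)) (w := fun i => ((c n * d n i : ℝ) : ℂ))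
      (fun i j hij => (hst n).1 (toC_injective hij)) (fun i => by
        have h2 := (hst n).sum_div_eq_zero i
        have h3 : ∑ j, (c n : ℂ) * ((d n j : ℂ) / (toC (z n i) - toC (z n j))) = 0 := by
          rw [← Finset.mul_sum, h2, mul_zero]
        rw [← h3]
        refine Finset.sum_congr rfl fun j _ => ?_
        push_cast
        ring) (x := toC x) (fun i hi => hx (zS n i) (toC_injective hi))
    have h4 := tsum_extend_apply (hzS n) (fun i => c n * (d n i : ℝ))
      (fun (s : S) r => (r : ℂ) / (toC x - toC s)) (fun s => by simp)
    have h5 := tsum_extend_apply (hzS n) (fun i => c n * (d n i : ℝ))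
      (fun (s : S) r => (r : ℂ) ^ 2 / (toC x - toC s) ^ 2) (fun s => by simp)
    exact (congrArg (· ^ 2) h4).trans (h1.trans h5.symm)
  · have hunit : ∀ f : Ω →ᵇ ℝ, ‖f‖ ≤ 1 →
        ∫ᵛ x, f x ∂•μ = 2 * Real.pi * ∑' s : S, a s * f s := by
      intro f hf
      have hfs : ∀ s : S, |f s| ≤ 1 := fun s => (f.norm_coe_le_norm s).trans hf
      have haf : Summable fun s : S => a s * f s := by
        refine Summable.of_norm_bounded ha fun s => ?_
        rw [norm_mul]
        exact mul_le_of_le_one_right (abs_nonneg _) (hfs s)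
      have h1 : ∀ n, |∑' s, α n s * f s - ∑' s : S, a s * f s| ≤ (1 / 4) ^ n := by
        intro n
        have hs : Summable fun s => |α n s - a s| := by
          refine Summable.of_nonneg_of_le (fun s => abs_nonneg _) (fun s => abs_sub _ _)
            ((hα n).add ha)
        rw [← (hαf n f).tsum_sub haf]
        refine le_trans ?_ (hαa n)
        rw [← Real.norm_eq_abs]
        refine tsum_of_norm_bounded hs.hasSum fun s => ?_
        rw [← sub_mul, norm_mul]
        exact mul_le_of_le_one_right (abs_nonneg _) (hfs s)
      have h2 : Tendsto (fun n => ∑' s, α n s * f s) atTop (𝓝 (∑' s : S, a s * f s)) := by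
        rw [tendsto_iff_norm_sub_tendsto_zero]
        exact squeeze_zero (fun _ => norm_nonneg _) h1 hε
      have h3 : Tendsto (fun n => 2 * Real.pi * ∑' s, α n s * f s) atTop
          (𝓝 (∫ᵛ x, f x ∂•μ)) := by
        rw [tendsto_iff_norm_sub_tendsto_zero]
        refine squeeze_zero (fun _ => norm_nonneg _) (fun n => ?_) hε
        rw [norm_sub_rev]
        exact hclose n f hf
      exact tendsto_nhds_unique h3 (h2.const_mul _)
    intro f
    -- Scaling reduces to the unit ball, where the dual norm gives information; the `+ 1` covers `f
    -- = 0`.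
    have hpos : 0 < ‖f‖ + 1 := by positivity
    have h1 := hunit ((‖f‖ + 1)⁻¹ • f) (by
      rw [norm_smul, norm_inv, Real.norm_of_nonneg hpos.le, inv_mul_le_one₀ hpos]
      linarith)
    have h2 : ∫ᵛ x, ((‖f‖ + 1)⁻¹ • f) x ∂•μ = (‖f‖ + 1)⁻¹ * ∫ᵛ x, f x ∂•μ :=
      VectorMeasure.integral_fun_smul _ _ (‖f‖ + 1)⁻¹ f
    have h3 : ∑' s : S, a s * ((‖f‖ + 1)⁻¹ • f) s = (‖f‖ + 1)⁻¹ * ∑' s : S, a s * f s := by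
      rw [← tsum_mul_left]
      refine tsum_congr fun s => ?_
      simp
      ring
    rw [h2, h3] at h1
    have h4 : (‖f‖ + 1)⁻¹ ≠ 0 := by positivity
    apply mul_left_cancel₀ h4
    rw [h1]
    ring

/-! ### Stability of the double-pole identity under `ℓ¹` convergence. -/

/-- Square sums and sums pass to the limit in `ℓ¹`. -/
theorem sq_tsum_eq_of_tendsto {ι : Type*} {β : ℕ → ι → ℂ} {b : ι → ℂ}
    (hb : Summable fun s => ‖b s‖) (hβ : ∀ n, Summable fun s => ‖β n s - b s‖)
    (hlim : Tendsto (fun n => ∑' s, ‖β n s - b s‖) atTop (𝓝 0))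
    (h : ∀ n, (∑' s, β n s) ^ 2 = ∑' s, β n s ^ 2) :
    (∑' s, b s) ^ 2 = ∑' s, b s ^ 2 := by
  have hβs : ∀ n, Summable (β n) := fun n => by
    have := (hβ n).of_norm.add hb.of_norm
    simpa using this
  have h1 : Tendsto (fun n => ∑' s, β n s) atTop (𝓝 (∑' s, b s)) := by
    rw [tendsto_iff_norm_sub_tendsto_zero]
    refine squeeze_zero (fun _ => norm_nonneg _) (fun n => ?_) hlim
    rw [← (hβs n).tsum_sub hb.of_norm]
    exact norm_tsum_le_tsum_norm (hβ n)
  have hsq : ∀ {c : ι → ℂ}, (Summable fun s => ‖c s‖) → Summable fun s => c s ^ 2 := by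
    intro c hc
    refine Summable.of_norm_bounded (hc.mul_left (∑' s, ‖c s‖)) fun s => ?_
    rw [norm_pow, sq]
    exact mul_le_mul_of_nonneg_right (hc.le_tsum s fun _ _ => norm_nonneg _) (norm_nonneg _)
  have hβn : ∀ n, Summable fun s => ‖β n s‖ := fun n =>
    Summable.of_nonneg_of_le (fun _ => norm_nonneg _)
      (fun s => by simpa using norm_add_le (β n s - b s) (b s)) ((hβ n).add hb)
  have h2 : Tendsto (fun n => ∑' s, β n s ^ 2) atTop (𝓝 (∑' s, b s ^ 2)) := by
    rw [tendsto_iff_norm_sub_tendsto_zero]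
    have h3 : Tendsto (fun n => (∑' s, ‖β n s - b s‖) *
        ((∑' s, ‖β n s - b s‖) + 2 * ∑' s, ‖b s‖)) atTop (𝓝 0) := by
      simpa using hlim.mul (hlim.add_const (2 * ∑' s, ‖b s‖))
    refine squeeze_zero (fun _ => norm_nonneg _) (fun n => ?_) h3
    rw [← (hsq (hβn n)).tsum_sub (hsq hb)]
    refine tsum_of_norm_bounded ((hβ n).hasSum.mul_right _) fun s => ?_
    -- In the second factor each term is at most the corresponding full `ℓ¹` norm, so the difference
    -- of the squares is controlled by the `ℓ¹` distance times a bounded quantity.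
    have h4 : β n s ^ 2 - b s ^ 2 = (β n s - b s) * ((β n s - b s) + 2 * b s) := by ring
    rw [h4, norm_mul]
    refine mul_le_mul_of_nonneg_left ((norm_add_le _ _).trans (add_le_add ?_ ?_)) (norm_nonneg _)
    · exact (hβ n).le_tsum s fun _ _ => norm_nonneg _
    · rw [norm_mul, Complex.norm_two]
      exact mul_le_mul_of_nonneg_left (hb.le_tsum s fun _ _ => norm_nonneg _) zero_le_two
  refine tendsto_nhds_unique (h1.pow 2) ?_
  simp_rw [h]
  exact h2

/-! ### Series of functions summable in `L¹`. -/

theorem enorm_tsum_le {ι E : Type*} [NormedAddCommGroup E] [CompleteSpace E] (f : ι → E) : ‖∑' s, f s‖ₑ ≤ ∑' s, ‖f s‖ₑ := by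
  by_cases h : ∑' s, ‖f s‖ₑ = ∞
  · rw [h]
    exact le_top
  · have h2 : Summable fun s => ‖f s‖ := by simpa using ENNReal.summable_toReal h
    rw [← ofReal_norm]
    refine (ENNReal.ofReal_le_ofReal (norm_tsum_le_tsum_norm h2)).trans ?_
    rw [ENNReal.ofReal_tsum_of_nonneg (fun _ => norm_nonneg _) h2]
    simp

section Series

variable {X ι E : Type*} [MeasurableSpace X] {ν : Measure X} [Countable ι]
  [NormedAddCommGroup E] {F : ι → X → E}

theorem lintegral_tsum_enorm_eq (hF : ∀ s, Integrable (F s) ν)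
    (hsum : Summable fun s => ∫ x, ‖F s x‖ ∂ν) :
    ∫⁻ x, ∑' s, ‖F s x‖ₑ ∂ν = ENNReal.ofReal (∑' s, ∫ x, ‖F s x‖ ∂ν) := by
  rw [lintegral_tsum fun s => (hF s).1.enorm,
    ENNReal.ofReal_tsum_of_nonneg (fun s => integral_nonneg fun _ => norm_nonneg _) hsum]
  refine tsum_congr fun s => ?_
  rw [ofReal_integral_norm_eq_lintegral_enorm (hF s)]

theorem ae_summable_norm (hF : ∀ s, Integrable (F s) ν)
    (hsum : Summable fun s => ∫ x, ‖F s x‖ ∂ν) :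
    ∀ᵐ x ∂ν, Summable fun s => ‖F s x‖ := by
  have h1 : ∫⁻ x, ∑' s, ‖F s x‖ₑ ∂ν ≠ ∞ := by
    rw [lintegral_tsum_enorm_eq hF hsum]
    exact ENNReal.ofReal_ne_top
  filter_upwards [ae_lt_top' (AEMeasurable.tsum fun s => (hF s).1.enorm) h1] with x hx
  have h2 := ENNReal.summable_toReal hx.ne
  simpa using h2

theorem integrable_tsum [CompleteSpace E] (hF : ∀ s, Integrable (F s) ν)
    (hsum : Summable fun s => ∫ x, ‖F s x‖ ∂ν) :
    Integrable (fun x => ∑' s, F s x) ν := by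
  refine ⟨?_, ?_⟩
  · refine aestronglyMeasurable_of_tendsto_ae (atTop : Filter (Finset ι))
      (f := fun T x => ∑ s ∈ T, F s x)
      (fun T => Finset.aestronglyMeasurable_fun_sum T fun s _ => (hF s).1) ?_
    filter_upwards [ae_summable_norm hF hsum] with x hx
    exact hx.of_norm.hasSum
  · refine lt_of_le_of_lt (lintegral_mono fun x => enorm_tsum_le _) ?_
    rw [lintegral_tsum_enorm_eq hF hsum]
    exact ENNReal.ofReal_lt_top

end Series

/-! ### Bounds for the kernels `1 / |x|` and `log |x|`. -/

theorem integrableOn_inv_norm_ball (R : ℝ) :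
    IntegrableOn (fun x : Plane => ‖x‖⁻¹) (Metric.ball 0 R) := by
  refine integrableOn_ball_of_norm_le_rpow (C := 1) (α := 1) (by simp) (by simp) ?_
    (by fun_prop)
  refine ae_of_all _ fun x => ?_
  rw [Real.rpow_neg_one, one_mul, norm_inv, norm_norm]

theorem locallyIntegrable_inv_norm : LocallyIntegrable fun x : Plane => ‖x‖⁻¹ := by
  rw [locallyIntegrable_iff]
  intro K hK
  obtain ⟨R, _, hR⟩ := hK.isBounded.exists_pos_norm_lt
  exact (integrableOn_inv_norm_ball R).mono_set fun x hx => mem_ball_zero_iff.2 (hR x hx)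

theorem integral_preimage_sub {f : Plane → ℝ} {R : ℝ} (p : Plane)
    (hf : IntegrableOn f (Metric.ball 0 R)) :
    IntegrableOn (fun x => f (x - p)) (Metric.ball p R) ∧
      ∫ x in Metric.ball p R, f (x - p) = ∫ x in Metric.ball 0 R, f x := by
  have hpre : (fun x => x - p) ⁻¹' (Metric.ball 0 R) = Metric.ball p R := by
    ext x
    simp [dist_eq_norm]
  have hm := measurePreserving_sub_right (volume : Measure Plane) p
  have he : MeasurableEmbedding fun x : Plane => x - p :=
    (Homeomorph.subRight p).measurableEmbedding
  rw [← hpre]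
  exact ⟨(hm.integrableOn_comp_preimage he).2 hf, hm.setIntegral_preimage_emb he _ _⟩

/-- On a bounded open set the functions `x ↦ ‖x - p‖⁻¹` are uniformly integrable in `p`. -/
theorem exists_integral_inv_norm_sub_le {Ω : Opens Plane}
    (hΩ : Bornology.IsBounded (Ω : Set Plane)) :
    ∃ C : ℝ, 0 ≤ C ∧ ∀ p ∈ Ω, IntegrableOn (fun x : Plane => ‖x - p‖⁻¹) Ω ∧
      ∫ x in (Ω : Set Plane), ‖x - p‖⁻¹ ≤ C := by
  obtain ⟨R, hR⟩ := hΩ.subset_ball 0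
  refine ⟨∫ x in Metric.ball (0 : Plane) (2 * R), ‖x‖⁻¹,
    integral_nonneg fun _ => by positivity, fun p hp => ?_⟩
  have hsub : (Ω : Set Plane) ⊆ Metric.ball p (2 * R) := by
    intro x hx
    have h1 := hR hx
    have h2 := hR hp
    rw [mem_ball_zero_iff] at h1 h2
    rw [Metric.mem_ball, dist_eq_norm]
    linarith [norm_sub_le x p]
  obtain ⟨h1, h2⟩ := integral_preimage_sub p (integrableOn_inv_norm_ball (2 * R))
  refine ⟨h1.mono_set hsub, ?_⟩
  rw [← h2]
  exact setIntegral_mono_set h1 (ae_of_all _ fun x => by positivity) hsub.eventuallyLE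

/-- Apply `log t ≤ t - 1` to `r` and to `r⁻¹`. At `r = 0` the default values `log 0 = 0` and `0⁻¹ =
0` make both sides vanish. -/
theorem abs_log_le {r : ℝ} (hr : 0 ≤ r) : |Real.log r| ≤ r + r⁻¹ := by
  rcases hr.eq_or_lt with rfl | hr
  · simp
  · have h1 := Real.log_le_sub_one_of_pos hr
    have h2 := Real.log_le_sub_one_of_pos (inv_pos.2 hr)
    rw [Real.log_inv] at h2
    have h3 := inv_pos.2 hr
    rw [abs_le]
    constructor <;> linarith

/-! ### The logarithm: weak gradient and fundamental solution. -/

/-- Integration by parts against a compactly supported function. -/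
theorem integral_mul_fderiv_eq_neg {f ψ : Plane → ℝ} (hf : ContDiff ℝ 1 f) (hψ : ContDiff ℝ 1 ψ)
    (hc : HasCompactSupport ψ) (v : Plane) :
    ∫ x, f x * fderiv ℝ ψ x v = -∫ x, fderiv ℝ f x v * ψ x := by
  have hf' : Continuous fun x => fderiv ℝ f x v :=
    (hf.continuous_fderiv one_ne_zero).clm_apply continuous_const
  have hψ' : Continuous fun x => fderiv ℝ ψ x v :=
    (hψ.continuous_fderiv one_ne_zero).clm_apply continuous_const
  have hc' : HasCompactSupport fun x => fderiv ℝ ψ x v := hc.fderiv_apply (𝕜 := ℝ) v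
  refine integral_mul_fderiv_eq_neg_fderiv_mul_of_integrable ?_ ?_ ?_
    (fun x _ => hf.differentiable one_ne_zero x) (fun x _ => hψ.differentiable one_ne_zero x)
  · exact (hf'.mul hψ.continuous).integrable_of_hasCompactSupport hc.mul_left
  · exact (hf.continuous.mul hψ').integrable_of_hasCompactSupport hc'.mul_left
  · exact (hf.continuous.mul hψ.continuous).integrable_of_hasCompactSupport hc.mul_left

theorem hasFDerivAt_norm_sq_add (e : ℝ) (y : Plane) :
    HasFDerivAt (fun y : Plane => ‖y‖ ^ 2 + e) ((2 : ℝ) • innerSL ℝ y) y := by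
  have h := (hasStrictFDerivAt_norm_sq y).hasFDerivAt
  exact (h.add_const e).congr_fderiv (by ext v; simp)

theorem fderiv_half_log {e : ℝ} (he : 0 < e) (y v : Plane) :
    fderiv ℝ (fun y : Plane => Real.log (‖y‖ ^ 2 + e) / 2) y v =
      (‖y‖ ^ 2 + e)⁻¹ * inner ℝ y v := by
  have hpos : ‖y‖ ^ 2 + e ≠ 0 := by positivity
  have h := ((hasFDerivAt_norm_sq_add e y).log hpos).mul_const (2⁻¹ : ℝ)
  have h2 : fderiv ℝ (fun y : Plane => Real.log (‖y‖ ^ 2 + e) / 2) y = _ := h.fderiv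
  rw [h2]
  simp
  ring

theorem contDiff_half_log {e : ℝ} (he : 0 < e) :
    ContDiff ℝ 1 (fun y : Plane => Real.log (‖y‖ ^ 2 + e) / 2) := by
  refine ContDiff.div_const (ContDiff.log (((contDiff_norm_sq ℝ)).add contDiff_const) ?_) _
  intro y
  positivity

/-- The bound is uniform in the regularization `e` and locally integrable in the plane, as dominated
convergence for `e → 0` requires. -/
theorem abs_half_log_le {e : ℝ} (he : 0 < e) (he1 : e ≤ 1) {r : ℝ} (hr : 0 ≤ r) (hr0 : r ≠ 0) :
    |Real.log (r ^ 2 + e) / 2| ≤ r⁻¹ + r ^ 2 := by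
  have hr' : 0 < r := lt_of_le_of_ne hr hr0.symm
  have h1 := Real.log_le_sub_one_of_pos (show 0 < r ^ 2 + e by positivity)
  have h2 : Real.log (r ^ 2) ≤ Real.log (r ^ 2 + e) :=
    Real.log_le_log (by positivity) (by linarith)
  rw [Real.log_pow] at h2
  have h3 := Real.log_le_sub_one_of_pos (inv_pos.2 hr')
  rw [Real.log_inv] at h3
  push_cast at h2
  have h4 := inv_pos.2 hr'
  rw [abs_le]
  constructor <;> nlinarith [sq_nonneg r]

theorem integrable_inv_norm_mul {f : Plane → ℝ} (hf : Continuous f) (hc : HasCompactSupport f) :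
    Integrable fun x : Plane => ‖x‖⁻¹ * f x := by
  have := locallyIntegrable_inv_norm.integrable_smul_right_of_hasCompactSupport hf hc
  simpa [mul_comm] using this

theorem ae_ne (p : Plane) : ∀ᵐ x : Plane, x ≠ p := by
  simp [ae_iff]

/-- The logarithm has weak gradient `y ↦ y / ‖y‖ ^ 2`. -/
theorem integral_log_mul_fderiv {ψ : Plane → ℝ} (hψ : ContDiff ℝ 1 ψ) (hc : HasCompactSupport ψ)
    (v : Plane) :
    ∫ y, Real.log ‖y‖ * fderiv ℝ ψ y v = -∫ y, (‖y‖ ^ 2)⁻¹ * inner ℝ y v * ψ y := by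
  have hψ' : Continuous fun x => fderiv ℝ ψ x v :=
    (hψ.continuous_fderiv one_ne_zero).clm_apply continuous_const
  have hc' : HasCompactSupport fun x => fderiv ℝ ψ x v := hc.fderiv_apply (𝕜 := ℝ) v
  have hev : ∀ᶠ e : ℝ in 𝓝[>] 0, 0 < e ∧ e ≤ 1 := by
    filter_upwards [Ioc_mem_nhdsGT (zero_lt_one' ℝ)] with e he using he
  have h1 : Tendsto (fun e : ℝ => ∫ y : Plane, Real.log (‖y‖ ^ 2 + e) / 2 * fderiv ℝ ψ y v)
      (𝓝[>] 0) (𝓝 (∫ y, Real.log ‖y‖ * fderiv ℝ ψ y v)) := by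
    refine tendsto_integral_filter_of_dominated_convergence
      (fun y => ‖y‖⁻¹ * |fderiv ℝ ψ y v| + ‖y‖ ^ 2 * |fderiv ℝ ψ y v|) ?_ ?_ ?_ ?_
    · filter_upwards [hev] with e he
      exact ((contDiff_half_log he.1).continuous.mul hψ').aestronglyMeasurable
    · filter_upwards [hev] with e he
      filter_upwards [ae_ne 0] with y hy
      rw [norm_mul, ← add_mul]
      exact mul_le_mul_of_nonneg_right (abs_half_log_le he.1 he.2 (norm_nonneg _)
        (norm_ne_zero_iff.2 hy)) (norm_nonneg _)
    · refine (integrable_inv_norm_mul hψ'.abs (hc'.comp_left abs_zero)).add ?_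
      exact ((by fun_prop : Continuous fun y : Plane => ‖y‖ ^ 2).mul
        hψ'.abs).integrable_of_hasCompactSupport (hc'.comp_left (g := abs) abs_zero).mul_left
    · filter_upwards [ae_ne 0] with y hy
      have hy' : ‖y‖ ^ 2 + 0 ≠ 0 := by simpa using hy
      have h2 : Tendsto (fun e : ℝ => Real.log (‖y‖ ^ 2 + e) / 2 * fderiv ℝ ψ y v) (𝓝 0)
          (𝓝 (Real.log (‖y‖ ^ 2 + 0) / 2 * fderiv ℝ ψ y v)) := by
        refine ((((Real.continuousAt_log hy').tendsto.comp ?_)).div_const _).mul_const _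
        exact tendsto_const_nhds.add tendsto_id
      have h3 : Real.log (‖y‖ ^ 2 + 0) / 2 = Real.log ‖y‖ := by
        rw [add_zero, Real.log_pow]
        push_cast
        ring
      rw [h3] at h2
      exact h2.mono_left nhdsWithin_le_nhds
  have h2 : Tendsto (fun e : ℝ => -∫ y : Plane, (‖y‖ ^ 2 + e)⁻¹ * inner ℝ y v * ψ y)
      (𝓝[>] 0) (𝓝 (-∫ y, (‖y‖ ^ 2)⁻¹ * inner ℝ y v * ψ y)) := by
    refine (tendsto_integral_filter_of_dominated_convergence
      (fun y => ‖v‖ * (‖y‖⁻¹ * |ψ y|)) ?_ ?_ ?_ ?_).neg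
    · filter_upwards [hev] with e he
      have : Continuous fun y : Plane => (‖y‖ ^ 2 + e)⁻¹ :=
        Continuous.inv₀ (by fun_prop) fun y => by have := he.1; positivity
      exact ((this.mul (by fun_prop)).mul hψ.continuous).aestronglyMeasurable
    · filter_upwards [hev] with e he
      filter_upwards [ae_ne 0] with y hy
      have hy' : 0 < ‖y‖ := norm_pos_iff.2 hy
      have he0 := he.1
      rw [norm_mul, norm_mul, norm_inv, Real.norm_of_nonneg (show 0 ≤ ‖y‖ ^ 2 + e by positivity),
        ← mul_assoc]
      refine mul_le_mul_of_nonneg_right ?_ (norm_nonneg _)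
      have h3 := norm_inner_le_norm (𝕜 := ℝ) y v
      calc (‖y‖ ^ 2 + e)⁻¹ * ‖inner ℝ y v‖ ≤ (‖y‖ ^ 2)⁻¹ * (‖y‖ * ‖v‖) := by
            gcongr
            linarith
        _ = ‖v‖ * ‖y‖⁻¹ := by field_simp
    · exact (integrable_inv_norm_mul hψ.continuous.abs (hc.comp_left abs_zero)).const_mul _
    · filter_upwards [ae_ne 0] with y hy
      have hy' : ‖y‖ ^ 2 + 0 ≠ 0 := by simpa using hy
      have h3 : Tendsto (fun e : ℝ => (‖y‖ ^ 2 + e)⁻¹ * inner ℝ y v * ψ y) (𝓝 0)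
          (𝓝 ((‖y‖ ^ 2 + 0)⁻¹ * inner ℝ y v * ψ y)) :=
        (((tendsto_const_nhds.add tendsto_id).inv₀ hy').mul_const _).mul_const _
      rw [add_zero] at h3
      exact h3.mono_left nhdsWithin_le_nhds
  refine tendsto_nhds_unique (h1.congr' ?_) h2
  filter_upwards [hev] with e he
  rw [integral_mul_fderiv_eq_neg (contDiff_half_log he.1) hψ hc]
  simp_rw [fderiv_half_log he.1]

/-- Polar coordinates, with primitive `-(1 + r²)⁻¹ / 2`. This is the mass of the peak function
below. -/
theorem integral_inv_one_add_norm_sq_sq :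
    ∫ w : Plane, ((1 + ‖w‖ ^ 2) ^ 2)⁻¹ = Real.pi := by
  have h1 := integral_fun_norm_addHaar (volume : Measure Plane) fun r : ℝ => ((1 + r ^ 2) ^ 2)⁻¹
  have h2 : ∫ y in Ioi (0 : ℝ), y * ((1 + y ^ 2) ^ 2)⁻¹ = 1 / 2 := by
    have hd : ∀ y ∈ Ioi (0 : ℝ), HasDerivAt (fun y : ℝ => -(1 + y ^ 2)⁻¹ / 2)
        (y * ((1 + y ^ 2) ^ 2)⁻¹) y := by
      intro y _
      have h3 : HasDerivAt (fun y : ℝ => 1 + y ^ 2) (2 * y) y := by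
        simpa using (hasDerivAt_pow 2 y).const_add 1
      have h4 := ((h3.inv (by positivity)).neg).div_const 2
      refine h4.congr_deriv ?_
      field_simp
    have hcont : ContinuousWithinAt (fun y : ℝ => -(1 + y ^ 2)⁻¹ / 2) (Ici 0) 0 := by
      apply Continuous.continuousWithinAt
      have : Continuous fun y : ℝ => (1 + y ^ 2)⁻¹ :=
        Continuous.inv₀ (by fun_prop) fun y => by positivity
      fun_prop
    have hlim : Tendsto (fun y : ℝ => -(1 + y ^ 2)⁻¹ / 2) atTop (𝓝 0) := by
      have h5 : Tendsto (fun y : ℝ => 1 + y ^ 2) atTop atTop :=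
        tendsto_atTop_add_const_left _ _ (tendsto_pow_atTop two_ne_zero)
      simpa using (h5.inv_tendsto_atTop.neg).div_const 2
    have h6 := integral_Ioi_of_hasDerivAt_of_nonneg hcont hd
      (fun y hy => by have : (0 : ℝ) < y := hy; positivity) hlim
    rw [h6]
    norm_num
  simp only [finrank_euclideanSpace, Fintype.card_fin, Nat.add_one_sub_one, pow_one, smul_eq_mul,
    h2] at h1
  rw [h1, Measure.real, EuclideanSpace.volume_ball_fin_two]
  simp only [ENNReal.ofReal_one, one_pow, one_mul, nsmul_eq_mul, Nat.cast_ofNat,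
    ENNReal.toReal_ofReal Real.pi_pos.le]
  ring

/-- With `e = c⁻¹ ^ 2`, the kernel is the divergence of `y / (‖y‖² + e)`. It is `2π` times the
rescaling by `c` of the probability density `π⁻¹ (1 + ‖w‖²)⁻²`, hence an approximate identity. -/
theorem tendsto_integral_peak {ψ : Plane → ℝ} (hψ : Continuous ψ) (hc : HasCompactSupport ψ) :
    Tendsto (fun c : ℝ => ∫ y : Plane, 2 * c⁻¹ ^ 2 / (‖y‖ ^ 2 + c⁻¹ ^ 2) ^ 2 * ψ y) atTop
      (𝓝 (2 * Real.pi * ψ 0)) := by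
  have h := tendsto_integral_comp_smul_smul_of_integrable (μ := (volume : Measure Plane))
    (φ := fun w => Real.pi⁻¹ * ((1 + ‖w‖ ^ 2) ^ 2)⁻¹) (fun w => by positivity)
    (by rw [integral_const_mul, integral_inv_one_add_norm_sq_sq, inv_mul_cancel₀ Real.pi_ne_zero])
    (by
      simp only [finrank_euclideanSpace, Fintype.card_fin]
      have h1 : Tendsto (fun w : Plane => Real.pi⁻¹ * (1 + ‖w‖ ^ 2)⁻¹) (Bornology.cobounded Plane)
          (𝓝 (Real.pi⁻¹ * 0)) := by
        refine Tendsto.const_mul _ (Tendsto.inv_tendsto_atTop ?_)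
        exact tendsto_atTop_add_const_left _ _
          ((tendsto_pow_atTop two_ne_zero).comp tendsto_norm_cobounded_atTop)
      rw [mul_zero] at h1
      refine squeeze_zero (fun w => by positivity) (fun w => ?_) h1
      have h2 : ‖w‖ ^ 2 ≤ 1 + ‖w‖ ^ 2 := by linarith
      calc ‖w‖ ^ 2 * (Real.pi⁻¹ * ((1 + ‖w‖ ^ 2) ^ 2)⁻¹)
          ≤ (1 + ‖w‖ ^ 2) * (Real.pi⁻¹ * ((1 + ‖w‖ ^ 2) ^ 2)⁻¹) := by gcongr
        _ = Real.pi⁻¹ * (1 + ‖w‖ ^ 2)⁻¹ := by field_simp)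
    (hψ.integrable_of_hasCompactSupport hc) hψ.continuousAt
  refine ((h.const_mul (2 * Real.pi)).congr' ?_)
  filter_upwards [eventually_gt_atTop 0] with c hcpos
  rw [← integral_const_mul]
  refine integral_congr_ae (ae_of_all _ fun y => ?_)
  simp only [finrank_euclideanSpace, Fintype.card_fin, norm_smul, Real.norm_of_nonneg hcpos.le,
    smul_eq_mul]
  have hpi := Real.pi_ne_zero
  have h3 : (1 + (c * ‖y‖) ^ 2) ≠ 0 := by positivity
  have h4 : ‖y‖ ^ 2 + c⁻¹ ^ 2 ≠ 0 := by positivity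
  have h5 : ‖y‖ ^ 2 + c⁻¹ ^ 2 = (c ^ 2)⁻¹ * (1 + (c * ‖y‖) ^ 2) := by
    field_simp
    ring
  rw [h5]
  field_simp

/-- The coordinate directions of the plane. -/
abbrev dir (i : Fin 2) : Plane := EuclideanSpace.single i (1 : ℝ)

theorem contDiff_div_norm_sq_add {e : ℝ} (he : 0 < e) (i : Fin 2) :
    ContDiff ℝ 1 fun y : Plane => (‖y‖ ^ 2 + e)⁻¹ * y i := by
  refine ContDiff.mul (ContDiff.inv ((contDiff_norm_sq ℝ).add contDiff_const) fun y => ?_)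
    (EuclideanSpace.proj i : Plane →L[ℝ] ℝ).contDiff
  positivity

theorem fderiv_div_norm_sq_add {e : ℝ} (he : 0 < e) (i : Fin 2) (y : Plane) :
    fderiv ℝ (fun y : Plane => (‖y‖ ^ 2 + e)⁻¹ * y i) y (dir i) =
      (‖y‖ ^ 2 + e)⁻¹ - 2 * y i ^ 2 / (‖y‖ ^ 2 + e) ^ 2 := by
  have hpos : ‖y‖ ^ 2 + e ≠ 0 := by positivity
  have h1 := (hasDerivAt_inv hpos).comp_hasFDerivAt y (hasFDerivAt_norm_sq_add e y)
  have h2 : HasFDerivAt (fun y : Plane => y i) (EuclideanSpace.proj i : Plane →L[ℝ] ℝ) y :=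
    (EuclideanSpace.proj i : Plane →L[ℝ] ℝ).hasFDerivAt
  have h3 := h1.mul h2
  have h4 : fderiv ℝ (fun y : Plane => (‖y‖ ^ 2 + e)⁻¹ * y i) y = _ := h3.fderiv
  rw [h4]
  simp [dir, EuclideanSpace.inner_single_right]
  field_simp
  ring

theorem abs_apply_le_norm (y : Plane) (i : Fin 2) : |y i| ≤ ‖y‖ :=
  PiLp.norm_apply_le y i

/-- The divergence of `y ↦ y / ‖y‖ ^ 2` is `2 π δ`. -/
theorem sum_integral_div_mul_fderiv {ψ : Plane → ℝ} (hψ : ContDiff ℝ 1 ψ)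
    (hc : HasCompactSupport ψ) :
    ∑ i, ∫ y : Plane, (‖y‖ ^ 2)⁻¹ * y i * fderiv ℝ ψ y (dir i) = -(2 * Real.pi * ψ 0) := by
  have hψ' : ∀ i, Continuous fun x => fderiv ℝ ψ x (dir i) := fun i =>
    (hψ.continuous_fderiv one_ne_zero).clm_apply continuous_const
  have hc' : ∀ i, HasCompactSupport fun x => fderiv ℝ ψ x (dir i) := fun i =>
    hc.fderiv_apply (𝕜 := ℝ) (dir i)
  have h1 : Tendsto (fun c : ℝ => ∑ i, ∫ y : Plane,
      (‖y‖ ^ 2 + c⁻¹ ^ 2)⁻¹ * y i * fderiv ℝ ψ y (dir i)) atTop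
      (𝓝 (∑ i, ∫ y : Plane, (‖y‖ ^ 2)⁻¹ * y i * fderiv ℝ ψ y (dir i))) := by
    refine tendsto_finsetSum _ fun i _ => ?_
    refine tendsto_integral_filter_of_dominated_convergence
      (fun y => ‖y‖⁻¹ * |fderiv ℝ ψ y (dir i)|) ?_ ?_ ?_ ?_
    · filter_upwards [eventually_gt_atTop 0] with c hcpos
      exact ((contDiff_div_norm_sq_add (show 0 < c⁻¹ ^ 2 by positivity) i).continuous.mul
        (hψ' i)).aestronglyMeasurable
    · filter_upwards [eventually_gt_atTop 0] with c hcpos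
      filter_upwards [ae_ne 0] with y hy
      have hy' : 0 < ‖y‖ := norm_pos_iff.2 hy
      rw [norm_mul, norm_mul, norm_inv,
        Real.norm_of_nonneg (show 0 ≤ ‖y‖ ^ 2 + c⁻¹ ^ 2 by positivity)]
      refine mul_le_mul_of_nonneg_right ?_ (norm_nonneg _)
      calc (‖y‖ ^ 2 + c⁻¹ ^ 2)⁻¹ * ‖y i‖ ≤ (‖y‖ ^ 2)⁻¹ * ‖y‖ := by
            gcongr
            · exact le_add_of_nonneg_right (by positivity)
            · exact abs_apply_le_norm y i
        _ = ‖y‖⁻¹ := by field_simp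
    · exact integrable_inv_norm_mul (hψ' i).abs ((hc' i).comp_left abs_zero)
    · filter_upwards [ae_ne 0] with y hy
      have hy' : ‖y‖ ^ 2 + 0 ^ 2 ≠ 0 := by simpa using hy
      have h3 : Tendsto (fun c : ℝ => (‖y‖ ^ 2 + c⁻¹ ^ 2)⁻¹ * y i * fderiv ℝ ψ y (dir i)) atTop
          (𝓝 ((‖y‖ ^ 2 + 0 ^ 2)⁻¹ * y i * fderiv ℝ ψ y (dir i))) :=
        (((tendsto_const_nhds.add (tendsto_inv_atTop_zero.pow 2)).inv₀ hy').mul_const _).mul_const _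
      simpa using h3
  refine tendsto_nhds_unique h1 ((tendsto_integral_peak hψ.continuous hc).neg.congr' ?_)
  filter_upwards [eventually_gt_atTop 0] with c hcpos
  have he : 0 < c⁻¹ ^ 2 := by positivity
  simp_rw [integral_mul_fderiv_eq_neg (contDiff_div_norm_sq_add he _) hψ hc]
  rw [Finset.sum_neg_distrib, ← integral_finsetSum]
  · congr 1
    refine integral_congr_ae (ae_of_all _ fun y => ?_)
    simp only [fderiv_div_norm_sq_add he, Fin.sum_univ_two]
    have h5 := norm_sq_eq y
    have h6 : ‖y‖ ^ 2 + c⁻¹ ^ 2 ≠ 0 := by positivity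
    have h7 : y 1 ^ 2 = ‖y‖ ^ 2 - y 0 ^ 2 := by linarith
    rw [h7, ← add_mul]
    congr 1
    generalize ‖y‖ ^ 2 = r at *
    generalize c⁻¹ ^ 2 = s at *
    field_simp
    ring
  · intro i _
    refine Continuous.integrable_of_hasCompactSupport ?_ hc.mul_left
    exact (((contDiff_div_norm_sq_add he i).continuous_fderiv one_ne_zero).clm_apply
      continuous_const).mul hψ.continuous

theorem fderiv_translate (φ : Plane → ℝ) (p y : Plane) :
    fderiv ℝ (fun y => φ (y + p)) y = fderiv ℝ φ (y + p) :=
  fderiv_comp_add_right p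

theorem hasCompactSupport_translate {φ : Plane → ℝ} (hc : HasCompactSupport φ) (p : Plane) :
    HasCompactSupport fun y => φ (y + p) :=
  hc.comp_homeomorph (Homeomorph.addRight p)

theorem contDiff_translate {n : WithTop ℕ∞} {φ : Plane → ℝ} (h : ContDiff ℝ n φ) (p : Plane) :
    ContDiff ℝ n fun y => φ (y + p) :=
  h.comp (contDiff_id.add contDiff_const)

/-- The logarithmic potential of a point has weak gradient `x ↦ (x - p) / ‖x - p‖ ^ 2`. -/
theorem integral_log_sub_mul_fderiv {φ : Plane → ℝ} (hφ : ContDiff ℝ 1 φ)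
    (hc : HasCompactSupport φ) (p v : Plane) :
    ∫ x, Real.log ‖x - p‖ * fderiv ℝ φ x v =
      -∫ x, (‖x - p‖ ^ 2)⁻¹ * inner ℝ (x - p) v * φ x := by
  have h := integral_log_mul_fderiv (contDiff_translate hφ p) (hasCompactSupport_translate hc p) v
  simp_rw [fderiv_translate] at h
  rw [← integral_sub_right_eq_self _ p, ← integral_sub_right_eq_self
    (fun y => (‖y‖ ^ 2)⁻¹ * inner ℝ y v * φ (y + p)) p] at h
  simpa using h

theorem integrable_log_sub_mul {f : Plane → ℝ} (hf : Continuous f) (hc : HasCompactSupport f)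
    (p : Plane) : Integrable fun x : Plane => Real.log ‖x - p‖ * f x := by
  have hf' : Continuous fun y => f (y + p) := by fun_prop
  have hc' := hasCompactSupport_translate hc p
  have h1 : Integrable fun y : Plane => Real.log ‖y‖ * f (y + p) := by
    refine Integrable.mono' (g := fun y => ‖y‖ * |f (y + p)| + ‖y‖⁻¹ * |f (y + p)|) ?_ ?_ ?_
    · refine Integrable.add ?_ (integrable_inv_norm_mul hf'.abs (hc'.comp_left abs_zero))
      exact (continuous_norm.mul hf'.abs).integrable_of_hasCompactSupport
        (hc'.comp_left (g := abs) abs_zero).mul_left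
    · exact ((Real.measurable_log.comp measurable_norm).mul hf'.measurable).aestronglyMeasurable
    · refine ae_of_all _ fun y => ?_
      rw [norm_mul, ← add_mul]
      exact mul_le_mul_of_nonneg_right (abs_log_le (norm_nonneg _)) (norm_nonneg _)
  simpa using h1.comp_sub_right p

theorem laplacian_eq_sum_fderiv {φ : Plane → ℝ} (hφ : ContDiff ℝ 2 φ) (x : Plane) :
    Laplacian.laplacian φ x = ∑ i, fderiv ℝ (fun z => fderiv ℝ φ z (dir i)) x (dir i) := by
  rw [InnerProductSpace.laplacian_eq_iteratedFDeriv_orthonormalBasis φ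
    (EuclideanSpace.basisFun (Fin 2) ℝ)]
  refine Finset.sum_congr rfl fun i _ => ?_
  rw [iteratedFDeriv_two_apply]
  have h1 : DifferentiableAt ℝ (fderiv ℝ φ) x :=
    (hφ.fderiv_right (m := 1) (by norm_num)).differentiable one_ne_zero x
  rw [fderiv_clm_apply h1 (differentiableAt_const _)]
  simp

/-- The logarithmic potential is a fundamental solution of the Laplacian. -/
theorem integral_log_sub_mul_laplacian {φ : Plane → ℝ} (hφ : ContDiff ℝ 2 φ)
    (hc : HasCompactSupport φ) (p : Plane) :
    ∫ x, Real.log ‖x - p‖ * Laplacian.laplacian φ x = 2 * Real.pi * φ p := by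
  have hd : ∀ i, ContDiff ℝ 1 fun z => fderiv ℝ φ z (dir i) := fun i =>
    (hφ.fderiv_right (m := 1) (by norm_num)).clm_apply contDiff_const
  have hdc : ∀ i, HasCompactSupport fun z => fderiv ℝ φ z (dir i) := fun i =>
    hc.fderiv_apply (𝕜 := ℝ) (dir i)
  have h1 := sum_integral_div_mul_fderiv (contDiff_translate (hφ.of_le one_le_two) p)
    (hasCompactSupport_translate hc p)
  simp_rw [fderiv_translate] at h1
  have h2 : ∀ i, ∫ y : Plane, (‖y‖ ^ 2)⁻¹ * y i * fderiv ℝ φ (y + p) (dir i) =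
      -∫ x, Real.log ‖x - p‖ * fderiv ℝ (fun z => fderiv ℝ φ z (dir i)) x (dir i) := fun i => by
    rw [integral_log_sub_mul_fderiv (hd i) (hdc i), neg_neg,
      ← integral_sub_right_eq_self _ p]
    refine integral_congr_ae (ae_of_all _ fun x => ?_)
    simp [EuclideanSpace.inner_single_right]
  simp_rw [h2, Finset.sum_neg_distrib, neg_inj, zero_add] at h1
  rw [← h1, ← integral_finsetSum]
  · refine integral_congr_ae (ae_of_all _ fun x => ?_)
    simp only [laplacian_eq_sum_fderiv hφ, Finset.mul_sum]
  · intro i _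
    have hcont : Continuous fun x => fderiv ℝ (fun z => fderiv ℝ φ z (dir i)) x (dir i) :=
      ((hd i).continuous_fderiv one_ne_zero).clm_apply continuous_const
    have hcs : HasCompactSupport fun x => fderiv ℝ (fun z => fderiv ℝ φ z (dir i)) x (dir i) :=
      (hdc i).fderiv_apply (𝕜 := ℝ) (dir i)
    exact integrable_log_sub_mul hcont hcs p

/-! ### Termwise integration and weak gradients of series. -/

section LinearSeries

variable {X ι E G : Type*} [MeasurableSpace X] {ν : Measure X} [Countable ι]
  [NormedAddCommGroup E] [NormedSpace ℝ E] [NormedAddCommGroup G] [NormedSpace ℝ G]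

theorem integrable_clm_apply {f : X → E} (hf : Integrable f ν) {T : X → E →L[ℝ] G}
    (hT : AEStronglyMeasurable T ν) {M : ℝ} (hM : ∀ x, ‖T x‖ ≤ M) :
    Integrable (fun x => T x (f x)) ν := by
  refine Integrable.mono' (hf.norm.const_mul M)
    (isBoundedBilinearMap_apply.continuous.comp_aestronglyMeasurable (hT.prodMk hf.1))
    (ae_of_all _ fun x => ?_)
  exact ((T x).le_opNorm _).trans (mul_le_mul_of_nonneg_right (hM x) (norm_nonneg _))

/-- Termwise integration of an `L¹`-summable series against a bounded field of linear maps. -/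
theorem hasSum_integral_clm_apply [CompleteSpace E] {F : ι → X → E}
    (hF : ∀ s, Integrable (F s) ν) (hsum : Summable fun s => ∫ x, ‖F s x‖ ∂ν) {T : X → E →L[ℝ] G}
    (hT : AEStronglyMeasurable T ν) {M : ℝ} (hM : ∀ x, ‖T x‖ ≤ M) :
    HasSum (fun s => ∫ x, T x (F s x) ∂ν) (∫ x, T x (∑' s, F s x) ∂ν) := by
  have h1 := hasSum_integral_of_summable_integral_norm (μ := ν)
    (F := fun s x => T x (F s x)) (fun s => integrable_clm_apply (hF s) hT hM)
    (by
      refine Summable.of_nonneg_of_le (fun s => integral_nonneg fun _ => norm_nonneg _)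
        (fun s => ?_) (hsum.mul_left M)
      rw [← integral_const_mul]
      refine integral_mono (integrable_clm_apply (hF s) hT hM).norm ((hF s).norm.const_mul M)
        fun x => ?_
      exact ((T x).le_opNorm _).trans (mul_le_mul_of_nonneg_right (hM x) (norm_nonneg _)))
  convert! h1 using 1
  refine integral_congr_ae ?_
  filter_upwards [ae_summable_norm hF hsum] with x hx
  exact (T x).map_tsum hx.of_norm

end LinearSeries

theorem continuous_gradient {φ : Plane → ℝ} (h : ContDiff ℝ 1 φ) : Continuous (gradient φ) :=
  (InnerProductSpace.toDual ℝ Plane).symm.continuous.comp (h.continuous_fderiv one_ne_zero)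

theorem hasCompactSupport_gradient {φ : Plane → ℝ} (h : HasCompactSupport φ) :
    HasCompactSupport (gradient φ) :=
  (h.fderiv (𝕜 := ℝ)).comp_left (map_zero (InnerProductSpace.toDual ℝ Plane).symm)

theorem gradient_eq_zero_of_notMem {φ : Plane → ℝ} {x : Plane} (hx : x ∉ tsupport φ) :
    gradient φ x = 0 := by
  rw [gradient, image_eq_zero_of_notMem_tsupport fun h => hx (tsupport_fderiv_subset ℝ h)]
  simp

theorem eq_zero_of_notMem {Ω : Opens Plane} (φ : 𝓓(Ω, ℝ)) {x : Plane} (hx : x ∉ Ω) : φ x = 0 :=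
  image_eq_zero_of_notMem_tsupport fun h => hx (φ.tsupport_subset h)

theorem contDiff_testFunction {Ω : Opens Plane} (φ : 𝓓(Ω, ℝ)) (n : ℕ) : ContDiff ℝ n φ :=
  φ.contDiff.of_le (by exact_mod_cast le_top)

theorem setIntegral_smul_gradient {Ω : Opens Plane} (φ : 𝓓(Ω, ℝ)) (u : Plane → ℝ) :
    ∫ x in (Ω : Set Plane), u x • gradient φ x = ∫ x, u x • gradient φ x :=
  setIntegral_eq_integral_of_forall_compl_eq_zero fun x hx => by
    rw [gradient_eq_zero_of_notMem fun h => hx (φ.tsupport_subset h), smul_zero]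

theorem setIntegral_testFunction_smul {Ω : Opens Plane} (φ : 𝓓(Ω, ℝ)) (g : Plane → Plane) :
    ∫ x in (Ω : Set Plane), φ x • g x = ∫ x, φ x • g x :=
  setIntegral_eq_integral_of_forall_compl_eq_zero fun x hx => by
    rw [eq_zero_of_notMem φ hx, zero_smul]

/-- A weak gradient may be tested direction by direction. -/
theorem hasWeakGradient_of_integral_fderiv {Ω : Opens Plane} {u : Plane → ℝ} {g : Plane → Plane}
    (hu : LocallyIntegrable u) (hg : LocallyIntegrable g)
    (h : ∀ ψ : Plane → ℝ, ContDiff ℝ 1 ψ → HasCompactSupport ψ → ∀ v,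
      ∫ x, u x * fderiv ℝ ψ x v = -∫ x, inner ℝ (g x) v * ψ x) :
    HasWeakGradient Ω u g := by
  refine ⟨hu.locallyIntegrableOn _, hg.locallyIntegrableOn _, fun φ => ?_⟩
  have hφ := contDiff_testFunction φ 1
  have hφc := φ.hasCompactSupport
  have i1 : Integrable fun x => u x • gradient φ x :=
    hu.integrable_smul_right_of_hasCompactSupport (continuous_gradient hφ)
      (hasCompactSupport_gradient hφc)
  have i2 : Integrable fun x => φ x • g x :=
    hg.integrable_smul_left_of_hasCompactSupport hφ.continuous hφc
  rw [setIntegral_smul_gradient, setIntegral_testFunction_smul]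
  refine ext_inner_left ℝ fun v => ?_
  rw [inner_neg_right, ← integral_inner i1, ← integral_inner i2]
  have h1 := h φ hφ hφc v
  convert! h1 using 1
  · refine integral_congr_ae (ae_of_all _ fun x => ?_)
    simp only [inner_smul_right, inner_gradient_right]
    simp
  · congr 1
    refine integral_congr_ae (ae_of_all _ fun x => ?_)
    simp only [inner_smul_right, real_inner_comm v]
    ring

/-- The weak gradient of a series converging in `L¹` together with its gradients. -/
theorem HasWeakGradient.tsum {ι : Type*} [Countable ι] {Ω : Opens Plane} {U : ι → Plane → ℝ}
    {G : ι → Plane → Plane} (h : ∀ s, HasWeakGradient Ω (U s) (G s))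
    (hU : ∀ s, IntegrableOn (U s) Ω) (hUs : Summable fun s => ∫ x in (Ω : Set Plane), ‖U s x‖)
    (hG : ∀ s, IntegrableOn (G s) Ω) (hGs : Summable fun s => ∫ x in (Ω : Set Plane), ‖G s x‖) :
    HasWeakGradient Ω (fun x => ∑' s, U s x) (fun x => ∑' s, G s x) := by
  have hU' : ∀ s, Integrable (U s) (volume.restrict (Ω : Set Plane)) := hU
  have hG' : ∀ s, Integrable (G s) (volume.restrict (Ω : Set Plane)) := hG
  have hUt : IntegrableOn (fun x => ∑' s, U s x) Ω := integrable_tsum hU' hUs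
  have hGt : IntegrableOn (fun x => ∑' s, G s x) Ω := integrable_tsum hG' hGs
  refine ⟨hUt.locallyIntegrableOn, hGt.locallyIntegrableOn, fun φ => ?_⟩
  have hφ := contDiff_testFunction φ 1
  have hφc := φ.hasCompactSupport
  obtain ⟨M1, hM1⟩ := (hasCompactSupport_gradient hφc).exists_bound_of_continuous
    (continuous_gradient hφ)
  obtain ⟨M2, hM2⟩ := hφc.exists_bound_of_continuous hφ.continuous
  have hT1 : Continuous fun x => ContinuousLinearMap.toSpanSingleton ℝ (gradient φ x) :=
    (ContinuousLinearMap.toSpanSingletonCLE (𝕜 := ℝ) (E := Plane)).continuous.comp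
      (continuous_gradient hφ)
  have h1 := hasSum_integral_clm_apply hU' hUs (T := fun x =>
    ContinuousLinearMap.toSpanSingleton ℝ (gradient φ x)) hT1.aestronglyMeasurable
    (M := M1) fun x => by simpa using hM1 x
  have hT2 : Continuous fun x => φ x • ContinuousLinearMap.id ℝ Plane :=
    hφ.continuous.smul continuous_const
  have h2 := hasSum_integral_clm_apply hG' hGs (T := fun x =>
    φ x • ContinuousLinearMap.id ℝ Plane) hT2.aestronglyMeasurable
    (M := M2) fun x => by
      rw [norm_smul, ContinuousLinearMap.norm_id, mul_one]
      exact hM2 x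
  have h3 := h2.neg
  refine h1.unique ?_
  convert! h3 using 1
  funext s
  exact (h s).integral_eq φ

/-! ### The logarithmic potential of an atomic measure. -/

/-- The velocity at `x` generated by a point vortex at `p`, rotated by a quarter turn. -/
def velocity (p x : Plane) : Plane := (‖x - p‖ ^ 2)⁻¹ • (x - p)

theorem norm_velocity (p x : Plane) : ‖velocity p x‖ = ‖x - p‖⁻¹ := by
  rw [velocity, norm_smul, norm_inv, norm_pow, norm_norm]
  rcases eq_or_ne ‖x - p‖ 0 with h | h
  · simp [h]
  · field_simp

theorem measurable_velocity (p : Plane) : Measurable (velocity p) := by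
  unfold velocity
  fun_prop

theorem locallyIntegrable_inv_norm_sub (p : Plane) :
    LocallyIntegrable fun x : Plane => ‖x - p‖⁻¹ := by
  rw [locallyIntegrable_iff]
  intro K hK
  obtain ⟨R, hR⟩ := hK.isBounded.subset_ball p
  exact (integral_preimage_sub p (integrableOn_inv_norm_ball R)).1.mono_set hR

theorem locallyIntegrable_log_norm_sub (p : Plane) :
    LocallyIntegrable fun x : Plane => Real.log ‖x - p‖ := by
  have h1 : LocallyIntegrable fun x : Plane => ‖x - p‖ :=
    Continuous.locallyIntegrable (by fun_prop)
  refine (h1.add (locallyIntegrable_inv_norm_sub p)).mono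
    (Real.measurable_log.comp (by fun_prop)).aestronglyMeasurable (ae_of_all _ fun x => ?_)
  refine (abs_log_le (norm_nonneg _)).trans ?_
  exact le_abs_self _

theorem hasWeakGradient_log (Ω : Opens Plane) (p : Plane) :
    HasWeakGradient Ω (fun x => Real.log ‖x - p‖) (velocity p) := by
  refine hasWeakGradient_of_integral_fderiv (locallyIntegrable_log_norm_sub p)
    ((locallyIntegrable_inv_norm_sub p).mono (measurable_velocity p).aestronglyMeasurable
      (ae_of_all _ fun x => ?_)) fun ψ hψ hc v => ?_
  · rw [norm_velocity, norm_inv, norm_norm]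
  · rw [integral_log_sub_mul_fderiv hψ hc]
    simp [velocity, inner_smul_left]

theorem HasWeakGradient.const_mul {Ω : Opens Plane} {u : Plane → ℝ} {g : Plane → Plane}
    (h : HasWeakGradient Ω u g) (c : ℝ) :
    HasWeakGradient Ω (fun x => c * u x) (fun x => c • g x) := by
  refine ⟨h.1.smul c, h.2.smul c, fun φ => ?_⟩
  have h1 : ∀ x, (c * u x) • gradient φ x = c • (u x • gradient φ x) := fun x => mul_smul _ _ _
  have h2 : ∀ x, φ x • c • g x = c • (φ x • g x) := fun x => smul_comm _ _ _
  simp_rw [h1, h2]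
  rw [integral_smul, integral_smul, h.integral_eq, smul_neg]

section Potential

variable {Ω : Opens Plane} {S : Set Ω}

/-- The logarithmic potential of the atomic measure with weights `2 π a s` at the points of `S`. -/
def potential (a : S → ℝ) (x : Plane) : ℝ := ∑' s : S, a s * Real.log ‖x - s‖

/-- The gradient of the logarithmic potential. -/
def potentialGrad (a : S → ℝ) (x : Plane) : Plane := ∑' s : S, a s • velocity s x

theorem exists_integral_log_sub_le (hΩ : Bornology.IsBounded (Ω : Set Plane)) :
    ∃ C : ℝ, ∀ p ∈ Ω, IntegrableOn (fun x : Plane => Real.log ‖x - p‖) Ω ∧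
      ∫ x in (Ω : Set Plane), ‖Real.log ‖x - p‖‖ ≤ C := by
  obtain ⟨C, hC0, hC⟩ := exists_integral_inv_norm_sub_le hΩ
  obtain ⟨R, hR⟩ := hΩ.subset_ball 0
  -- Two points of `Ω` are at distance `t ≤ 2R`, so `t + t⁻¹ ≤ ((2R)² + 1) t⁻¹` and the uniform
  -- bound for `1 / |x - p|` applies.
  refine ⟨((2 * R) ^ 2 + 1) * C, fun p hp => ?_⟩
  obtain ⟨h1, h2⟩ := hC p hp
  have hbound : ∀ᵐ x ∂volume.restrict (Ω : Set Plane),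
      ‖Real.log ‖x - p‖‖ ≤ ((2 * R) ^ 2 + 1) * ‖x - p‖⁻¹ := by
    refine (ae_restrict_iff' Ω.isOpen.measurableSet).2 (ae_of_all _ fun x hx => ?_)
    refine (abs_log_le (norm_nonneg _)).trans ?_
    have h3 := hR hx
    have h4 := hR hp
    rw [mem_ball_zero_iff] at h3 h4
    have h5 : ‖x - p‖ ≤ 2 * R := by linarith [norm_sub_le x p]
    rcases (norm_nonneg (x - p)).eq_or_lt with h0 | h0
    · simp [← h0]
    · have h6 : ‖x - p‖ = ‖x - p‖ ^ 2 * ‖x - p‖⁻¹ := by field_simp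
      rw [add_mul, one_mul]
      refine add_le_add_left ?_ _
      calc ‖x - p‖ = ‖x - p‖ ^ 2 * ‖x - p‖⁻¹ := h6
        _ ≤ (2 * R) ^ 2 * ‖x - p‖⁻¹ := by gcongr
  have hint : IntegrableOn (fun x : Plane => Real.log ‖x - p‖) Ω :=
    Integrable.mono' (h1.const_mul _)
      (Real.measurable_log.comp (by fun_prop)).aestronglyMeasurable hbound
  refine ⟨hint, ?_⟩
  calc ∫ x in (Ω : Set Plane), ‖Real.log ‖x - p‖‖
      ≤ ∫ x in (Ω : Set Plane), ((2 * R) ^ 2 + 1) * ‖x - p‖⁻¹ :=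
        integral_mono_ae hint.norm (h1.const_mul _) hbound
    _ = ((2 * R) ^ 2 + 1) * ∫ x in (Ω : Set Plane), ‖x - p‖⁻¹ := integral_const_mul _ _
    _ ≤ _ := by gcongr

/-- Weighted families of functions with bounded integrals are summable in `L¹`. -/
theorem summable_integral_norm_smul {X ι E : Type*} [MeasurableSpace X] {ν : Measure X}
    [NormedAddCommGroup E] [NormedSpace ℝ E] {a : ι → ℝ} (ha : Summable fun s => |a s|)
    {f : ι → X → E} {C : ℝ} (hf : ∀ s, ∫ x, ‖f s x‖ ∂ν ≤ C) :
    Summable fun s => ∫ x, ‖a s • f s x‖ ∂ν := by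
  refine Summable.of_nonneg_of_le (fun s => integral_nonneg fun _ => norm_nonneg _) (fun s => ?_)
    (ha.mul_right C)
  simp_rw [norm_smul]
  rw [integral_const_mul]
  exact mul_le_mul_of_nonneg_left (hf s) (norm_nonneg _)

theorem exists_integral_velocity_le (hΩ : Bornology.IsBounded (Ω : Set Plane)) :
    ∃ C : ℝ, ∀ p ∈ Ω, IntegrableOn (velocity p) Ω ∧
      ∫ x in (Ω : Set Plane), ‖velocity p x‖ ≤ C := by
  obtain ⟨C, hC0, hC⟩ := exists_integral_inv_norm_sub_le hΩ
  refine ⟨C, fun p hp => ?_⟩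
  obtain ⟨h1, h2⟩ := hC p hp
  refine ⟨Integrable.mono' h1 (measurable_velocity p).aestronglyMeasurable
    (ae_of_all _ fun x => (norm_velocity p x).le), ?_⟩
  simp_rw [norm_velocity]
  exact h2

theorem hasWeakGradient_potential (hΩ : Bornology.IsBounded (Ω : Set Plane)) (hS : S.Countable)
    {a : S → ℝ} (ha : Summable fun s => |a s|) :
    HasWeakGradient Ω (potential a) (potentialGrad a) := by
  have : Countable S := hS
  obtain ⟨C, hC⟩ := exists_integral_log_sub_le hΩ
  obtain ⟨C', hC'⟩ := exists_integral_velocity_le hΩ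
  exact HasWeakGradient.tsum (U := fun (s : S) x => a s * Real.log ‖x - s‖)
    (G := fun (s : S) x => a s • velocity s x)
    (fun s => (hasWeakGradient_log Ω s).const_mul (a s))
    (fun s => (hC s s.1.2).1.const_mul _)
    (summable_integral_norm_smul ha fun s => (hC s s.1.2).2)
    (fun s => (hC' s s.1.2).1.smul (a s))
    (summable_integral_norm_smul ha fun s => (hC' s s.1.2).2)

/-- A test function on `Ω` as a bounded continuous function on `Ω`. -/
def restrictTest (φ : 𝓓(Ω, ℝ)) : Ω →ᵇ ℝ :=
  (φ : Plane →ᵇ ℝ).compContinuous ⟨Subtype.val, continuous_subtype_val⟩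

theorem restrictTest_apply (φ : 𝓓(Ω, ℝ)) (x : Ω) : restrictTest φ x = φ x := rfl

theorem hasWeakLaplacian_potential (hΩ : Bornology.IsBounded (Ω : Set Plane)) (hS : S.Countable)
    {a : S → ℝ} (ha : Summable fun s => |a s|) {μ : SignedMeasure Ω}
    (hμ : ∀ f : Ω →ᵇ ℝ, ∫ᵛ x, f x ∂•μ = 2 * Real.pi * ∑' s : S, a s * f s) :
    HasWeakLaplacian Ω (potential a) μ := by
  have : Countable S := hS
  intro φ
  have hφ := contDiff_testFunction φ 2
  obtain ⟨C, hC⟩ := exists_integral_log_sub_le hΩ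
  have hlap : Laplacian.laplacian (φ : Plane → ℝ) =
      fun x => ∑ i, fderiv ℝ (fun z => fderiv ℝ φ z (dir i)) x (dir i) :=
    funext (laplacian_eq_sum_fderiv hφ)
  have hd : ∀ i, ContDiff ℝ 1 fun z => fderiv ℝ φ z (dir i) := fun i =>
    (hφ.fderiv_right (m := 1) (by norm_num)).clm_apply contDiff_const
  have hcont : Continuous (Laplacian.laplacian (φ : Plane → ℝ)) := by
    rw [hlap]
    exact continuous_finsetSum _ fun i _ =>
      ((hd i).continuous_fderiv one_ne_zero).clm_apply continuous_const
  have hz : ∀ x ∉ tsupport φ, Laplacian.laplacian (φ : Plane → ℝ) x = 0 := by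
    intro x hx
    rw [hlap]
    refine Finset.sum_eq_zero fun i _ => ?_
    have h0 : fderiv ℝ (fun z => fderiv ℝ φ z (dir i)) x = 0 :=
      image_eq_zero_of_notMem_tsupport fun h =>
        hx (tsupport_fderiv_apply_subset ℝ (dir i) (tsupport_fderiv_subset ℝ h))
    rw [h0, zero_apply]
  obtain ⟨M, hM⟩ := (HasCompactSupport.intro φ.hasCompactSupport hz).exists_bound_of_continuous
    hcont
  have hT : Continuous fun x => Laplacian.laplacian (φ : Plane → ℝ) x •
      ContinuousLinearMap.id ℝ ℝ := hcont.smul continuous_const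
  have h1 := hasSum_integral_clm_apply (ν := volume.restrict (Ω : Set Plane))
    (F := fun (s : S) x => a s • Real.log ‖x - s‖)
    (fun s => (hC s s.1.2).1.const_mul _)
    (summable_integral_norm_smul ha fun s => (hC s s.1.2).2)
    hT.aestronglyMeasurable (M := M) fun x => by
      rw [norm_smul, ContinuousLinearMap.norm_id, mul_one]
      exact hM x
  have h2 : ∀ s : S, ∫ x in (Ω : Set Plane), (Laplacian.laplacian (φ : Plane → ℝ) x •
      ContinuousLinearMap.id ℝ ℝ) (a s • Real.log ‖x - s‖) = 2 * Real.pi * (a s * φ s) := by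
    intro s
    have h3 := integral_log_sub_mul_laplacian hφ φ.hasCompactSupport (s : Plane)
    rw [setIntegral_eq_integral_of_forall_compl_eq_zero fun x hx => by
      rw [hz x fun h => hx (φ.tsupport_subset h)]
      simp]
    have h4 : ∀ x : Plane, (Laplacian.laplacian (φ : Plane → ℝ) x •
        ContinuousLinearMap.id ℝ ℝ) (a s • Real.log ‖x - s‖) =
        a s * (Real.log ‖x - s‖ * Laplacian.laplacian (φ : Plane → ℝ) x) := fun x => by
      simp
      ring
    simp_rw [h4]
    rw [integral_const_mul, h3]
    ring
  simp_rw [h2] at h1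
  have h5 := h1.tsum_eq
  rw [tsum_mul_left] at h5
  have h6 := hμ (restrictTest φ)
  simp_rw [restrictTest_apply] at h6
  rw [h6, h5]
  refine integral_congr_ae (ae_of_all _ fun x => ?_)
  simp [potential, mul_comm]

end Potential

/-! ### The Hopf differential of the limit and the stress-energy tensor. -/

section Hopf

variable {Ω : Opens Plane} {S : Set Ω}

theorem norm_ofReal_div_sub (r : ℝ) (x p : Plane) :
    ‖(r : ℂ) / (toC x - toC p)‖ = |r| * ‖x - p‖⁻¹ := by
  rw [← toC_sub, norm_div, norm_toC, Complex.norm_real, Real.norm_eq_abs, div_eq_mul_inv]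

/-- The index set is kept general, with repeated points allowed, so that `ℕ × S` handles the errors
of all approximations on a single null set. -/
theorem ae_summable_abs_mul_inv_norm (hΩ : Bornology.IsBounded (Ω : Set Plane)) {ι : Type*}
    [Countable ι] (p : ι → Ω) {w : ι → ℝ} (hw : Summable fun s => |w s|) :
    ∀ᵐ x ∂volume.restrict (Ω : Set Plane), Summable fun s => |w s| * ‖x - (p s : Plane)‖⁻¹ := by
  obtain ⟨C, -, hC⟩ := exists_integral_inv_norm_sub_le hΩ
  have h := ae_summable_norm (ν := volume.restrict (Ω : Set Plane))
    (F := fun s (x : Plane) => w s • ‖x - (p s : Plane)‖⁻¹) (fun s => (hC _ (p s).2).1.const_mul _)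
    (summable_integral_norm_smul (C := C) hw fun s => by
      simp_rw [norm_inv, norm_norm]
      exact (hC _ (p s).2).2)
  filter_upwards [h] with x hx
  simpa [norm_smul] using hx

theorem ae_forall_ne (hS : S.Countable) :
    ∀ᵐ x : Plane ∂volume.restrict (Ω : Set Plane), ∀ s : S, x ≠ s := by
  have : Countable S := hS
  exact ae_restrict_of_ae (ae_all_iff.2 fun s => ae_ne ((s : Ω) : Plane))

/-- If rational functions without regular part at their poles converge, in the sense that their
coefficients do in `ℓ¹`, then the square of the limit has only double poles. -/
theorem ae_sq_tsum_eq (hΩ : Bornology.IsBounded (Ω : Set Plane)) (hS : S.Countable)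
    {α : ℕ → S → ℝ} {a : S → ℝ} (ha : Summable fun s => |a s|)
    (hα : ∀ n, (Function.support (α n)).Finite)
    (hαa : ∀ n, ∑' s, |α n s - a s| ≤ (1 / 4) ^ n)
    (h : ∀ n (x : Plane), (∀ s : S, x ≠ s) →
      (∑' s : S, (α n s : ℂ) / (toC x - toC s)) ^ 2 =
        ∑' s : S, (α n s : ℂ) ^ 2 / (toC x - toC s) ^ 2) :
    ∀ᵐ x ∂volume.restrict (Ω : Set Plane),
      (Summable fun s : S => (a s : ℂ) / (toC x - toC s)) ∧
      (∑' s : S, (a s : ℂ) / (toC x - toC s)) ^ 2 =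
        ∑' s : S, (a s : ℂ) ^ 2 / (toC x - toC s) ^ 2 := by
  have : Countable S := hS
  have hsum : ∀ n, Summable fun s => |α n s - a s| := fun n =>
    Summable.of_nonneg_of_le (fun s => abs_nonneg _) (fun s => abs_sub _ _)
      ((summable_of_hasFiniteSupport ((hα n).subset fun s hs => by simpa using hs)).add ha)
  -- Double summability over `(n, s)` makes `∑ |α n s - a s| / |x - s|` summable in `n` for almost
  -- every `x`; in particular it tends to zero.
  have hprod : Summable fun q : ℕ × S => |α q.1 q.2 - a q.2| := by
    refine (summable_prod_of_nonneg fun q => abs_nonneg _).2 ⟨hsum, ?_⟩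
    exact Summable.of_nonneg_of_le (fun n => tsum_nonneg fun _ => abs_nonneg _) hαa
      (summable_geometric_of_lt_one (by norm_num) (by norm_num))
  filter_upwards [ae_summable_abs_mul_inv_norm hΩ (fun s : S => s.1) ha, ae_forall_ne hS,
    ae_summable_abs_mul_inv_norm hΩ (fun q : ℕ × S => q.2.1) hprod] with x hx1 hx2 hx3
  have hb : Summable fun s : S => ‖(a s : ℂ) / (toC x - toC s)‖ := by
    simpa only [norm_ofReal_div_sub] using hx1
  refine ⟨hb.of_norm, ?_⟩
  have hdiff : ∀ n (s : S), ‖(α n s : ℂ) / (toC x - toC s) - (a s : ℂ) / (toC x - toC s)‖ =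
      |α n s - a s| * ‖x - s‖⁻¹ := fun n s => by
    rw [← sub_div, ← Complex.ofReal_sub, norm_ofReal_div_sub]
  have hx4 := (summable_prod_of_nonneg fun q => by positivity).1 hx3
  have hsq := sq_tsum_eq_of_tendsto (β := fun n (s : S) => (α n s : ℂ) / (toC x - toC s)) hb
    (fun n => by simpa only [hdiff] using hx4.1 n)
    (by simpa only [hdiff] using hx4.2.tendsto_atTop_zero)
    (fun n => by simpa only [div_pow] using h n x hx2)
  simpa only [div_pow] using hsq

/-- The rows of the stress-energy tensor, as linear functions of the Hopf differential
`(∂ₓu - i ∂ᵧu) ^ 2`. -/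
def rowOf (i : Fin 2) (q : ℂ) : Plane :=
  if i = 0 then !₂[-(1 / 2) * q.re, (1 / 2) * q.im] else !₂[(1 / 2) * q.im, (1 / 2) * q.re]

/-- The linear map underlying `rowOf`. -/
def rowOfL (i : Fin 2) : ℂ →L[ℝ] Plane :=
  LinearMap.toContinuousLinearMap
    { toFun := rowOf i
      map_add' := fun p q => by
        fin_cases i <;> ext j <;> fin_cases j <;> simp [rowOf] <;> ring
      map_smul' := fun r q => by
        fin_cases i <;> ext j <;> fin_cases j <;> simp [rowOf] <;> ring }

theorem rowOfL_apply (i : Fin 2) (q : ℂ) : rowOfL i q = rowOf i q := rfl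

theorem norm_rowOf_le (i : Fin 2) (q : ℂ) : ‖rowOf i q‖ ≤ ‖q‖ := by
  refine le_of_sq_le_sq ?_ (norm_nonneg _)
  rw [norm_sq_eq, Complex.sq_norm, Complex.normSq_apply]
  fin_cases i <;> simp [rowOf] <;> nlinarith [sq_nonneg q.re, sq_nonneg q.im]

theorem tensorRow_stressEnergy (g : Plane → Plane) (i : Fin 2) (x : Plane) :
    tensorRow (fun x => stressEnergy (g x)) i x =
      rowOf i (((starRingEnd ℂ) (toC (g x))) ^ 2) := by
  fin_cases i <;> ext j <;> fin_cases j <;>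
    simp [rowOf, tensorRow, stressEnergy, toC, sq] <;> ring

/-- `toC` as a continuous linear map. -/
def toCL : Plane →L[ℝ] ℂ :=
  LinearMap.toContinuousLinearMap
    { toFun := toC
      map_add' := fun v w => by apply Complex.ext <;> simp [toC]
      map_smul' := fun r v => by apply Complex.ext <;> simp [toC] }

theorem toCL_apply (v : Plane) : toCL v = toC v := rfl

theorem conj_toC_velocity (p x : Plane) :
    (starRingEnd ℂ) (toC (velocity p x)) = (toC x - toC p)⁻¹ := by
  rw [velocity, toC_smul, map_mul, Complex.conj_ofReal, ← toC_sub, Complex.inv_def, normSq_toC,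
    mul_comm]

theorem norm_inv_toC_sub_sq (x p : Plane) : ‖((toC x - toC p) ^ 2)⁻¹‖ = ‖x - p‖⁻¹ ^ 2 := by
  rw [← toC_sub, norm_inv, norm_pow, norm_toC, inv_pow]

/-- The elementary stress-energy field of a unit vortex at `p`. -/
def rowField (i : Fin 2) (p x : Plane) : Plane := rowOf i ((toC x - toC p) ^ 2)⁻¹

theorem norm_rowField_le (i : Fin 2) (p x : Plane) : ‖rowField i p x‖ ≤ ‖x - p‖⁻¹ ^ 2 :=
  (norm_rowOf_le _ _).trans (norm_inv_toC_sub_sq x p).le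

theorem measurable_rowField (i : Fin 2) (p : Plane) : Measurable (rowField i p) :=
  (rowOfL i).continuous.measurable.comp ((measurable_toC.sub_const _).pow_const 2).inv

/-- The conjugate of the gradient is `∑ a s / (x - s)`; its square is a series of double poles, and
`rowOf i`, being linear and continuous, acts on that series termwise. -/
theorem ae_tensorRow_eq (hΩ : Bornology.IsBounded (Ω : Set Plane)) (hS : S.Countable) {a : S → ℝ}
    (ha : Summable fun s => |a s|)
    (h : ∀ᵐ x ∂volume.restrict (Ω : Set Plane),
      (Summable fun s : S => (a s : ℂ) / (toC x - toC s)) ∧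
      (∑' s : S, (a s : ℂ) / (toC x - toC s)) ^ 2 =
        ∑' s : S, (a s : ℂ) ^ 2 / (toC x - toC s) ^ 2) (i : Fin 2) :
    ∀ᵐ x ∂volume.restrict (Ω : Set Plane),
      tensorRow (fun x => stressEnergy (potentialGrad a x)) i x =
        ∑' s : S, a s ^ 2 • rowField i s x := by
  have : Countable S := hS
  filter_upwards [h, ae_summable_abs_mul_inv_norm hΩ (fun s : S => s.1) ha] with x hx hx2
  have hv : Summable fun s : S => a s • velocity s x := by
    refine Summable.of_norm ?_
    simpa [norm_smul, norm_velocity] using hx2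
  have h1 : (starRingEnd ℂ) (toC (potentialGrad a x)) =
      ∑' s : S, (a s : ℂ) / (toC x - toC s) := by
    rw [potentialGrad, ← toCL_apply, toCL.map_tsum hv, ← Complex.conjCLE_apply,
      Complex.conjCLE.map_tsum]
    refine tsum_congr fun s => ?_
    rw [toCL_apply, toC_smul, Complex.conjCLE_apply, map_mul, conj_toC_velocity,
      Complex.conj_ofReal, div_eq_mul_inv]
  have h2 : Summable fun s : S => (a s : ℂ) ^ 2 / (toC x - toC s) ^ 2 := by
    have hn : Summable fun s : S => ‖(a s : ℂ) / (toC x - toC s)‖ := hx.1.norm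
    refine Summable.of_norm_bounded
      (hn.mul_left (∑' s : S, ‖(a s : ℂ) / (toC x - toC s)‖)) fun s => ?_
    rw [← div_pow, norm_pow, sq]
    exact mul_le_mul_of_nonneg_right (hn.le_tsum s fun _ _ => norm_nonneg _) (norm_nonneg _)
  rw [tensorRow_stressEnergy, h1, hx.2, ← rowOfL_apply, (rowOfL i).map_tsum h2]
  refine tsum_congr fun s => ?_
  rw [rowField, ← rowOfL_apply, ← map_smul, div_eq_mul_inv]
  congr 1
  rw [Complex.real_smul]
  push_cast
  rfl

end Hopf

/-! ### Fluxes of rotated gradients over preimages of Borel sets. -/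

section FinitePart

/-- Rotated gradients are divergence-free. -/
theorem integral_curl_eq_zero {F w : Plane → ℝ} (hF : ContDiff ℝ 2 F) (hw : ContDiff ℝ 1 w)
    (hc : HasCompactSupport w) :
    ∫ x, (fderiv ℝ F x (dir 1) * fderiv ℝ w x (dir 0) -
      fderiv ℝ F x (dir 0) * fderiv ℝ w x (dir 1)) = 0 := by
  have hF1 : ContDiff ℝ 1 (fderiv ℝ F) := hF.fderiv_right (by norm_num)
  have hd : ∀ i, ContDiff ℝ 1 fun z => fderiv ℝ F z (dir i) := fun i =>
    hF1.clm_apply contDiff_const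
  have hi : ∀ i j, Integrable fun x => fderiv ℝ F x (dir i) * fderiv ℝ w x (dir j) := fun i j =>
    ((hd i).continuous.mul ((hw.continuous_fderiv one_ne_zero).clm_apply
      continuous_const)).integrable_of_hasCompactSupport (hc.fderiv_apply (𝕜 := ℝ) (dir j)).mul_left
  rw [integral_sub (hi 1 0) (hi 0 1), integral_mul_fderiv_eq_neg (hd 1) hw hc,
    integral_mul_fderiv_eq_neg (hd 0) hw hc, sub_eq_zero, neg_inj]
  refine integral_congr_ae (ae_of_all _ fun x => ?_)
  have h2 : ∀ i j, fderiv ℝ (fun z => fderiv ℝ F z (dir i)) x (dir j) =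
      fderiv ℝ (fderiv ℝ F) x (dir j) (dir i) := fun i j => by
    rw [fderiv_clm_apply (hF1.differentiable one_ne_zero x) (differentiableAt_const _)]
    simp
  have hsymm : IsSymmSndFDerivAt ℝ F x := hF.contDiffAt.isSymmSndFDerivAt (by simp)
  simp only [h2]
  rw [hsymm.eq]

/-- If `m` integrates all continuous functions of `ζ` to zero, then it integrates to zero on the
preimages by `ζ` of Borel sets. -/
theorem setIntegral_preimage_eq_zero {X : Type*} [MeasurableSpace X] {ν : Measure X}
    {m ζ : X → ℝ} (hm : Integrable m ν) (hζ : Measurable ζ)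
    (h : ∀ f : ℝ →ᵇ ℝ, ∫ x, f (ζ x) * m x ∂ν = 0) {D : Set ℝ} (hD : MeasurableSet D) :
    ∫ x in ζ ⁻¹' D, m x ∂ν = 0 := by
  -- Densities require a measurable function; an almost everywhere equal representative changes no
  -- integral.
  wlog hmm : Measurable m generalizing m
  · have h1 := hm.1.aemeasurable
    have h2 : m =ᵐ[ν] h1.mk m := h1.ae_eq_mk
    rw [setIntegral_congr_ae (g := h1.mk m) (hζ hD) (h2.mono fun x hx _ => hx)]
    refine this (hm.congr h2) (fun f => ?_) h1.measurable_mk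
    rw [← h f]
    refine integral_congr_ae ?_
    filter_upwards [h2] with x hx
    rw [hx]
  -- The positive and negative parts of `m` are pushed forward to finite measures on `ℝ`. The
  -- hypothesis says that these have the same integrals of bounded continuous functions, so they
  -- coincide, in particular on `D`.
  have key : ∀ m' : X → ℝ, Integrable m' ν → Measurable m' →
      IsFiniteMeasure ((ν.withDensity fun x => ENNReal.ofReal (m' x)).map ζ) ∧
      (∀ f : ℝ →ᵇ ℝ, ∫ t, f t ∂((ν.withDensity fun x => ENNReal.ofReal (m' x)).map ζ) =
        ∫ x, f (ζ x) * max (m' x) 0 ∂ν) ∧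
      ((ν.withDensity fun x => ENNReal.ofReal (m' x)).map ζ) D =
        ∫⁻ x in ζ ⁻¹' D, ENNReal.ofReal (m' x) ∂ν := by
    intro m' hm' hmeas
    have hfin : IsFiniteMeasure (ν.withDensity fun x => ENNReal.ofReal (m' x)) :=
      isFiniteMeasure_withDensity_ofReal hm'.2
    refine ⟨inferInstance, fun f => ?_, ?_⟩
    · rw [integral_map hζ.aemeasurable f.continuous.aestronglyMeasurable,
        integral_withDensity_eq_integral_toReal_smul hmeas.ennreal_ofReal
          (ae_of_all _ fun x => ENNReal.ofReal_lt_top)]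
      refine integral_congr_ae (ae_of_all _ fun x => ?_)
      simp only [ENNReal.toReal_ofReal', smul_eq_mul]
      ring
    · rw [Measure.map_apply hζ hD, withDensity_apply _ (hζ hD)]
  obtain ⟨f1, i1, d1⟩ := key m hm hmm
  obtain ⟨f2, i2, d2⟩ := key (fun x => -m x) hm.neg hmm.neg
  have heq := ext_of_forall_integral_eq_of_IsFiniteMeasure
    (μ := (ν.withDensity fun x => ENNReal.ofReal (m x)).map ζ)
    (ν := (ν.withDensity fun x => ENNReal.ofReal (-m x)).map ζ) fun f => by
    have hb : ∀ m' : X → ℝ, Integrable m' ν → Integrable (fun x => f (ζ x) * max (m' x) 0) ν :=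
      fun m' hm' => (hm'.pos_part).bdd_mul
        ((f.continuous.measurable.comp hζ).aestronglyMeasurable)
        (ae_of_all _ fun x => f.norm_coe_le_norm (ζ x))
    rw [i1, i2, ← sub_eq_zero, ← integral_sub (hb m hm) (hb (fun x => -m x) hm.neg)]
    refine Eq.trans ?_ (h f)
    refine integral_congr_ae (ae_of_all _ fun x => ?_)
    simp only
    rw [← mul_sub]
    congr 1
    rcases le_total (m x) 0 with h0 | h0
    · rw [max_eq_right h0, max_eq_left (by linarith)]
      ring
    · rw [max_eq_left h0, max_eq_right (by linarith)]
      ring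
  rw [integral_eq_lintegral_pos_part_sub_lintegral_neg_part hm.integrableOn, ← d1, ← d2, heq,
    sub_self]

/-- A rotated gradient, multiplied by a gradient, integrates to zero on the preimages of Borel
sets. -/
theorem setIntegral_preimage_curl_eq_zero {F ζ : Plane → ℝ} (hF : ContDiff ℝ 2 F)
    (hζ : ContDiff ℝ 1 ζ) (hc : HasCompactSupport ζ) {D : Set ℝ} (hD : MeasurableSet D) :
    ∫ x in ζ ⁻¹' D, (fderiv ℝ F x (dir 1) * fderiv ℝ ζ x (dir 0) -
      fderiv ℝ F x (dir 0) * fderiv ℝ ζ x (dir 1)) = 0 := by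
  have hF1 : ContDiff ℝ 1 (fderiv ℝ F) := hF.fderiv_right (by norm_num)
  have hi : ∀ i j, Integrable fun x => fderiv ℝ F x (dir i) * fderiv ℝ ζ x (dir j) := fun i j =>
    ((hF1.continuous.clm_apply continuous_const).mul
      ((hζ.continuous_fderiv one_ne_zero).clm_apply
      continuous_const)).integrable_of_hasCompactSupport (hc.fderiv_apply (𝕜 := ℝ) (dir j)).mul_left
  refine setIntegral_preimage_eq_zero ((hi 1 0).sub (hi 0 1)) hζ.continuous.measurable
    (fun f => ?_) hD
  -- With `H` a primitive of `f`, `f(ζ) ∇ζ` is the gradient of `H ∘ ζ`. The normalization `H 0 = 0`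
  -- keeps the support compact.
  let H : ℝ → ℝ := fun t => ∫ s in (0 : ℝ)..t, f s
  have hH : ∀ t, HasDerivAt H (f t) t := fun t =>
    intervalIntegral.integral_hasDerivAt_right (f.continuous.intervalIntegrable _ _)
      f.continuous.aestronglyMeasurable.stronglyMeasurableAtFilter f.continuous.continuousAt
  have hHd : deriv H = f := funext fun t => (hH t).deriv
  have hH1 : ContDiff ℝ 1 H := by
    rw [contDiff_one_iff_deriv, hHd]
    exact ⟨fun t => (hH t).differentiableAt, f.continuous⟩
  have hw : ∀ x, fderiv ℝ (fun x => H (ζ x)) x = f (ζ x) • fderiv ℝ ζ x := fun x =>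
    ((hH (ζ x)).comp_hasFDerivAt x (hζ.differentiable one_ne_zero x).hasFDerivAt).fderiv
  have h0 := integral_curl_eq_zero hF (hH1.comp hζ)
    (hc.comp_left (g := H) intervalIntegral.integral_same)
  rw [← h0]
  refine integral_congr_ae (ae_of_all _ fun x => ?_)
  simp only [Function.comp_def, hw, smul_apply, smul_eq_mul, Pi.sub_apply]
  ring

/-- The stream function of `rowField i p`. -/
def rowStream (i : Fin 2) (p x : Plane) : ℝ :=
  if i = 0 then ((toC x - toC p)⁻¹).im / 2 else ((toC x - toC p)⁻¹).re / 2

theorem hasFDerivAt_inv_toC_sub {p x : Plane} (hx : x ≠ p) :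
    HasFDerivAt (fun x => (toC x - toC p)⁻¹) (-((toC x - toC p) ^ 2)⁻¹ • toCL) x := by
  have h1 : HasFDerivAt (fun x => toC x - toC p) toCL x := toCL.hasFDerivAt.sub_const _
  have h2 : toC x - toC p ≠ 0 := sub_ne_zero.2 fun h => hx (toC_injective h)
  exact (hasDerivAt_inv h2).comp_hasFDerivAt x h1

theorem fderiv_rowStream (i : Fin 2) {p x : Plane} (hx : x ≠ p) (v : Plane) :
    fderiv ℝ (rowStream i p) x v = if i = 0 then (-((toC x - toC p) ^ 2)⁻¹ * toC v).im / 2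
      else (-((toC x - toC p) ^ 2)⁻¹ * toC v).re / 2 := by
  have h := hasFDerivAt_inv_toC_sub hx
  fin_cases i
  · have h1 := ((Complex.imCLM.hasFDerivAt.comp x h).mul_const (2⁻¹ : ℝ)).fderiv
    have h2 : fderiv ℝ (rowStream 0 p) x = _ := h1
    simp only [Fin.zero_eta, h2]
    simp [toCL_apply]
    ring
  · have h1 := ((Complex.reCLM.hasFDerivAt.comp x h).mul_const (2⁻¹ : ℝ)).fderiv
    have h2 : fderiv ℝ (rowStream 1 p) x = _ := h1
    simp only [Fin.mk_one, h2]
    simp [toCL_apply]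
    ring

theorem contDiffAt_rowStream (i : Fin 2) {p x : Plane} (hx : x ≠ p) :
    ContDiffAt ℝ 2 (rowStream i p) x := by
  have h2 : toC x - toC p ≠ 0 := sub_ne_zero.2 fun h => hx (toC_injective h)
  have h1 : ContDiffAt ℝ 2 (fun x => (toC x - toC p)⁻¹) x :=
    (toCL.contDiff.contDiffAt.sub contDiffAt_const).inv h2
  fin_cases i
  · exact (Complex.imCLM.contDiff.contDiffAt.comp x h1).div_const 2
  · exact (Complex.reCLM.contDiff.contDiffAt.comp x h1).div_const 2

theorem gradient_apply (ζ : Plane → ℝ) (x : Plane) (i : Fin 2) :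
    gradient ζ x i = fderiv ℝ ζ x (dir i) := by
  have h := inner_gradient_left (𝕜 := ℝ) (f := ζ) (x := x) (y := dir i)
  rw [← h, dir, EuclideanSpace.inner_single_right, one_mul, conj_trivial]

/-- Since `1 / z` has complex derivative `-1 / z²`, the field is the stream function's gradient
turned by a quarter turn, `(∂₁, -∂₀)`. -/
theorem inner_rowField_gradient (i : Fin 2) {p x : Plane} (hx : x ≠ p) (ζ : Plane → ℝ) :
    inner ℝ (rowField i p x) (gradient ζ x) =
      fderiv ℝ (rowStream i p) x (dir 1) * fderiv ℝ ζ x (dir 0) -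
        fderiv ℝ (rowStream i p) x (dir 0) * fderiv ℝ ζ x (dir 1) := by
  have h0 : toC (dir 0) = 1 := by apply Complex.ext <;> simp [toC, dir]
  have h1 : toC (dir 1) = Complex.I := by apply Complex.ext <;> simp [toC, dir]
  rw [fderiv_rowStream i hx, fderiv_rowStream i hx, h0, h1, rowField]
  generalize ((toC x - toC p) ^ 2)⁻¹ = q
  rw [PiLp.inner_apply, Fin.sum_univ_two, gradient_apply, gradient_apply]
  fin_cases i <;> simp [rowOf] <;> ring

/-- The stress-energy field of a vortex, integrated against a gradient away from a neighbourhood of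
the vortex, on the preimage of a Borel set. -/
theorem setIntegral_inner_rowField_eq_zero (i : Fin 2) (p : Plane) {ρ : ℝ} (hρ : 0 < ρ)
    {ζ : Plane → ℝ} (hζ : ContDiff ℝ 1 ζ) (hc : HasCompactSupport ζ) {D : Set ℝ}
    (hD : MeasurableSet D) (hpD : ∀ x ∈ Metric.ball p ρ, ζ x ∉ D) :
    ∫ x in ζ ⁻¹' D, inner ℝ (rowField i p x) (gradient ζ x) = 0 := by
  -- The cutoff removes the singularity at `p` and changes the stream function only within distance
  -- `ρ / 2`, whereas `ζ⁻¹(D)` stays outside the disc of radius `ρ`.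
  let χ : ContDiffBump p := ⟨ρ / 4, ρ / 2, by positivity, by linarith⟩
  let F : Plane → ℝ := fun x => (1 - χ x) * rowStream i p x
  have hF : ContDiff ℝ 2 F := by
    rw [contDiff_iff_contDiffAt]
    intro x
    by_cases hx : x = p
    · have h1 : F =ᶠ[𝓝 x] fun _ => 0 := by
        rw [hx]
        filter_upwards [χ.eventuallyEq_one] with y hy
        simp [F, hy]
      exact contDiffAt_const.congr_of_eventuallyEq h1
    · exact (contDiffAt_const.sub χ.contDiffAt).mul (contDiffAt_rowStream i hx)
  rw [← setIntegral_preimage_curl_eq_zero hF hζ hc hD]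
  refine setIntegral_congr_fun (hζ.continuous.measurable hD) fun x hx => ?_
  have hxb : ρ ≤ dist x p := by
    by_contra hcon
    exact hpD x (Metric.mem_ball.2 (not_le.1 hcon)) hx
  have hxp : x ≠ p := fun h => by
    rw [h, dist_self] at hxb
    linarith
  have h1 : F =ᶠ[𝓝 x] rowStream i p := by
    have h2 : ∀ᶠ y in 𝓝 x, ρ / 2 < dist y p :=
      (continuous_id.dist continuous_const).continuousAt.eventually_const_lt
        (show ρ / 2 < dist x p by linarith)
    filter_upwards [h2] with y hy
    have : χ y = 0 := χ.zero_of_le_dist hy.le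
    simp [F, this]
  simp only [h1.fderiv_eq]
  exact inner_rowField_gradient i hxp ζ

end FinitePart

/-! ### The `1`-capacity of unions of discs. -/

section Capacity

theorem oneCapacity_mono {A B : Set Plane} (h : A ⊆ B) : oneCapacity A ≤ oneCapacity B := by
  unfold oneCapacity
  gcongr with φ g h1 h2 h3
  exact iInf_const_mono fun h' => h.trans h'

theorem oneCapacity_le {A : Set Plane} {φ : Plane → ℝ} {g : Plane → Plane}
    (h1 : MemLp φ 2 volume) (h2 : Integrable g volume) (h3 : HasWeakGradient ⊤ φ g)
    (h4 : A ⊆ interior {x | 1 ≤ φ x}) : oneCapacity A ≤ ∫⁻ x, ‖g x‖ₑ :=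
  iInf_le_of_le φ (iInf_le_of_le g (iInf_le_of_le h1 (iInf_le_of_le h2 (iInf_le_of_le h3
    (iInf_le_of_le h4 le_rfl)))))

theorem hasWeakGradient_gradient (Ω : Opens Plane) {φ : Plane → ℝ} (h : ContDiff ℝ 1 φ) :
    HasWeakGradient Ω φ (gradient φ) := by
  refine hasWeakGradient_of_integral_fderiv h.continuous.locallyIntegrable
    (continuous_gradient h).locallyIntegrable fun ψ hψ hc v => ?_
  rw [integral_mul_fderiv_eq_neg h hψ hc]
  simp_rw [inner_gradient_left]

theorem HasWeakGradient.congr_ae {Ω : Opens Plane} {u v : Plane → ℝ} {g : Plane → Plane}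
    (h : HasWeakGradient Ω u g) (huv : u =ᵐ[volume] v) : HasWeakGradient Ω v g := by
  refine ⟨?_, h.2, fun φ => ?_⟩
  · intro x hx
    obtain ⟨t, ht, hi⟩ := h.1 x hx
    exact ⟨t, ht, hi.congr (ae_restrict_of_ae huv)⟩
  · rw [← h.3 φ]
    refine integral_congr_ae (ae_restrict_of_ae ?_)
    filter_upwards [huv] with x hx
    rw [hx]

theorem gradient_comp_inv_smul_sub {χ : Plane → ℝ} (hχ : Differentiable ℝ χ) (p : Plane) (r : ℝ)
    (x : Plane) :
    gradient (fun x => χ (r⁻¹ • (x - p))) x = r⁻¹ • gradient χ (r⁻¹ • (x - p)) := by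
  have h1 : HasFDerivAt (fun x : Plane => r⁻¹ • (x - p)) (r⁻¹ • ContinuousLinearMap.id ℝ Plane) x :=
    ((hasFDerivAt_id x).sub_const p).const_smul r⁻¹
  have h2 := ((hχ (r⁻¹ • (x - p))).hasFDerivAt.comp x h1).fderiv
  have h3 : fderiv ℝ (fun x => χ (r⁻¹ • (x - p))) x = r⁻¹ • fderiv ℝ χ (r⁻¹ • (x - p)) := by
    refine h2.trans ?_
    ext v
    simp
  rw [gradient, h3, map_smul]
  rfl

theorem integral_comp_inv_smul_sub (f : Plane → ℝ) (p : Plane) (r : ℝ) :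
    ∫ x, f (r⁻¹ • (x - p)) = r ^ 2 * ∫ x, f x := by
  rw [integral_sub_right_eq_self (fun y => f (r⁻¹ • y)) p, Measure.integral_comp_inv_smul]
  simp [abs_of_nonneg (sq_nonneg r)]

/-- Cutoff functions of discs, with the scaling of their norms. -/
theorem exists_disc_cutoff : ∃ C : ℝ, 0 ≤ C ∧ ∀ (p : Plane) (r : ℝ), 0 ≤ r → ∃ φ : Plane → ℝ,
    ContDiff ℝ 1 φ ∧ HasCompactSupport φ ∧ (∀ x, 0 ≤ φ x) ∧ (∀ x ∈ Metric.ball p r, φ x = 1) ∧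
    ∫ x, ‖φ x‖ ≤ C * r ^ 2 ∧ ∫ x, ‖gradient φ x‖ ≤ C * r ∧
    eLpNorm φ 2 volume ≤ ENNReal.ofReal (C * r) := by
  let χ : ContDiffBump (0 : Plane) := ⟨1, 2, one_pos, one_lt_two⟩
  have hχ : ContDiff ℝ 1 χ := χ.contDiff
  have hc : HasCompactSupport χ := χ.hasCompactSupport
  let A0 := ∫ x, ‖χ x‖
  let A1 := ∫ x, ‖gradient χ x‖
  let A2 := Real.sqrt (∫ x, ‖χ x‖ ^ 2)
  have hA0 : 0 ≤ A0 := integral_nonneg fun _ => norm_nonneg _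
  have hA1 : 0 ≤ A1 := integral_nonneg fun _ => norm_nonneg _
  have hA2 : 0 ≤ A2 := Real.sqrt_nonneg _
  refine ⟨A0 + A1 + A2, by positivity, fun p r hr => ?_⟩
  rcases hr.eq_or_lt with rfl | hr0
  · exact ⟨fun _ => 0, contDiff_const, HasCompactSupport.zero, fun _ => le_rfl, by simp, by simp,
      by simp [gradient_fun_const], by simp⟩
  · have hφ : ContDiff ℝ 1 fun x => χ (r⁻¹ • (x - p)) :=
      hχ.comp ((contDiff_id.sub contDiff_const).const_smul r⁻¹)
    have hφc : HasCompactSupport fun x => χ (r⁻¹ • (x - p)) := by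
      have h1 := hc.comp_homeomorph
        ((Homeomorph.subRight p).trans (Homeomorph.smulOfNeZero r⁻¹ (inv_ne_zero hr0.ne')))
      exact h1
    refine ⟨fun x => χ (r⁻¹ • (x - p)), hφ, hφc, fun x => χ.nonneg, fun x hx => ?_, ?_, ?_, ?_⟩
    · refine χ.one_of_mem_closedBall ?_
      rw [Metric.mem_ball, dist_eq_norm] at hx
      rw [mem_closedBall_zero_iff, norm_smul, norm_inv, Real.norm_of_nonneg hr,
        inv_mul_le_one₀ hr0]
      exact hx.le
    · rw [integral_comp_inv_smul_sub (fun y => ‖χ y‖) p r, mul_comm]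
      have : A0 ≤ A0 + A1 + A2 := by linarith
      gcongr
    · simp_rw [gradient_comp_inv_smul_sub (hχ.differentiable one_ne_zero), norm_smul, norm_inv,
        Real.norm_of_nonneg hr]
      rw [integral_const_mul, integral_comp_inv_smul_sub (fun y => ‖gradient χ y‖) p r]
      have h2 : r⁻¹ * (r ^ 2 * ∫ x, ‖gradient χ x‖) = A1 * r := by
        simp only [A1]
        field_simp
      rw [h2]
      have : A1 ≤ A0 + A1 + A2 := by linarith
      gcongr
    · have hmem : MemLp (fun x => χ (r⁻¹ • (x - p))) 2 volume :=
        hφ.continuous.memLp_of_hasCompactSupport hφc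
      rw [hmem.eLpNorm_eq_integral_rpow_norm two_ne_zero ENNReal.ofNat_ne_top]
      refine ENNReal.ofReal_le_ofReal ?_
      simp only [ENNReal.toReal_ofNat, Real.rpow_ofNat]
      rw [integral_comp_inv_smul_sub (fun y => ‖χ y‖ ^ 2) p r, ← one_div, ← Real.sqrt_eq_rpow,
        Real.sqrt_mul (sq_nonneg r), Real.sqrt_sq hr, mul_comm]
      have : A2 ≤ A0 + A1 + A2 := by linarith
      gcongr

/-- The `1`-capacity of a countable union of discs is controlled by the sum of the radii. -/
theorem exists_oneCapacity_iUnion_ball_le : ∃ C : ℝ, 0 ≤ C ∧ ∀ {ι : Type} [Countable ι]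
    (p : ι → Plane) (r : ι → ℝ), (∀ s, 0 ≤ r s) → Summable r →
    oneCapacity (⋃ s, Metric.ball (p s) (r s)) ≤ ENNReal.ofReal (C * ∑' s, r s) := by
  obtain ⟨C, hC0, hC⟩ := exists_disc_cutoff
  refine ⟨C, hC0, fun {ι} _ p r hr hrs => ?_⟩
  choose φ hφ hφc hφ0 hφ1 hI0 hI1 hI2 using fun s => hC (p s) (r s) (hr s)
  have hint : ∀ s, Integrable (φ s) := fun s =>
    (hφ s).continuous.integrable_of_hasCompactSupport (hφc s)
  have hintg : ∀ s, Integrable (gradient (φ s)) := fun s =>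
    (continuous_gradient (hφ s)).integrable_of_hasCompactSupport
      (hasCompactSupport_gradient (hφc s))
  have hsq : Summable fun s => r s ^ 2 := by
    refine Summable.of_nonneg_of_le (fun s => sq_nonneg _) (fun s => ?_)
      (hrs.mul_left (∑' s, r s))
    rw [sq]
    exact mul_le_mul_of_nonneg_right (hrs.le_tsum s fun _ _ => hr _) (hr s)
  have hs0 : Summable fun s => ∫ x, ‖φ s x‖ :=
    Summable.of_nonneg_of_le (fun s => integral_nonneg fun _ => norm_nonneg _) hI0
      (hsq.mul_left C)
  have hs1 : Summable fun s => ∫ x, ‖gradient (φ s) x‖ :=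
    Summable.of_nonneg_of_le (fun s => integral_nonneg fun _ => norm_nonneg _) hI1
      (hrs.mul_left C)
  have hL2 : MemLp (fun x => ∑' s, φ s x) 2 volume := by
    have hm : ∀ s, MemLp (φ s) 2 volume := fun s =>
      (hφ s).continuous.memLp_of_hasCompactSupport (hφc s)
    have : Fact ((1 : ℝ≥0∞) ≤ 2) := ⟨one_le_two⟩
    have h1 := Lp.coeFn_tsum (f := fun s => (hm s).toLp (φ s)) (by
      simp_rw [Lp.enorm_toLp]
      refine ne_top_of_le_ne_top ?_ (ENNReal.tsum_le_tsum hI2)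
      rw [← ENNReal.ofReal_tsum_of_nonneg (fun s => mul_nonneg hC0 (hr s)) (hrs.mul_left C)]
      exact ENNReal.ofReal_ne_top)
    refine (memLp_congr_ae ?_).1 (Lp.memLp (∑' s, (hm s).toLp (φ s)))
    refine h1.trans ?_
    filter_upwards [ae_all_iff.2 fun s => (hm s).coeFn_toLp] with x hx
    simp_rw [hx]
  classical
  -- The inequality `Φ ≥ 1` is needed at every point of the discs, so the sum is replaced by `1`
  -- where the series diverges. This happens only on a null set and does not affect the weak
  -- gradient.
  let Φ : Plane → ℝ := fun x => if Summable fun s => φ s x then ∑' s, φ s x else 1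
  have hΦ : (fun x => ∑' s, φ s x) =ᵐ[volume] Φ := by
    filter_upwards [ae_summable_norm hint hs0] with x hx
    simp only [Φ]
    rw [if_pos hx.of_norm]
  have hW : HasWeakGradient ⊤ (fun x => ∑' s, φ s x) (fun x => ∑' s, gradient (φ s) x) :=
    HasWeakGradient.tsum (fun s => hasWeakGradient_gradient ⊤ (hφ s))
      (fun s => (hint s).integrableOn) (by simpa using hs0)
      (fun s => (hintg s).integrableOn) (by simpa using hs1)
  refine (oneCapacity_le ((memLp_congr_ae hΦ).1 hL2) (integrable_tsum hintg hs1)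
    (hW.congr_ae hΦ) ?_).trans ?_
  · refine interior_maximal (iUnion_subset fun s x hx => ?_)
      (isOpen_iUnion fun s => Metric.isOpen_ball)
    simp only [mem_ofPred_eq, Φ]
    split_ifs with h
    · rw [← hφ1 s x hx]
      exact h.le_tsum s fun t _ => hφ0 t x
    · exact le_rfl
  · refine (lintegral_mono fun x => enorm_tsum_le _).trans ?_
    rw [lintegral_tsum_enorm_eq hintg hs1]
    refine ENNReal.ofReal_le_ofReal ?_
    rw [← tsum_mul_left]
    exact hs1.tsum_le_tsum hI1 (hrs.mul_left C)

end Capacity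

/-! ### Removal of the vortex cores and the finite-part property. -/

section Assembly

variable {Ω : Opens Plane} {S : Set Ω}

/-- The union, in `Ω`, of the discs centred at the vortices, with radii proportional to the absolute
values of their weights. -/
def vortexCores (a : S → ℝ) (δ : ℝ) : Set Plane :=
  Ω ∩ ⋃ s : S, Metric.ball (s : Plane) (δ * |a s|)

theorem isOpen_vortexCores (a : S → ℝ) (δ : ℝ) : IsOpen (vortexCores a δ) :=
  Ω.isOpen.inter (isOpen_iUnion fun _ => Metric.isOpen_ball)

/-- An open subset of the plane is a countable union of compact sets, and so is its image. For a
general Borel set the image need not be Borel, which is why open cores are used. -/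
theorem measurableSet_image_of_isOpen {E : Set Plane} (hE : IsOpen E) {ζ : Plane → ℝ}
    (hζ : Continuous ζ) : MeasurableSet (ζ '' E) := by
  have : LocallyCompactSpace E := hE.isOpenEmbedding_subtypeVal.locallyCompactSpace
  have h1 : IsSigmaCompact E := isSigmaCompact_iff_sigmaCompactSpace.2
    sigmaCompactSpace_of_locallyCompact_secondCountable
  obtain ⟨K, hK, hKE⟩ := h1.image hζ
  rw [← hKE]
  exact MeasurableSet.iUnion fun n => (hK n).measurableSet

/-- The radius `δ |a s|` trades one power of `|x - s|⁻¹` and one factor `|a s|` for `δ⁻¹`. The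
remaining factor `|a s|` makes the bounds summable over `s`. -/
theorem integrableOn_smul_rowField (hΩ : Bornology.IsBounded (Ω : Set Plane)) (a : S → ℝ) {δ : ℝ}
    (hδ : 0 < δ) (i : Fin 2) (s : S) :
    IntegrableOn (fun x => a s ^ 2 • rowField i s x) (Ω \ vortexCores a δ) ∧
      ∀ C, ∫ x in (Ω : Set Plane), ‖x - s‖⁻¹ ≤ C →
        ∫ x in (Ω \ vortexCores a δ : Set Plane), ‖a s ^ 2 • rowField i s x‖ ≤
          |a s| * (δ⁻¹ * C) := by
  obtain ⟨C', -, hC'⟩ := exists_integral_inv_norm_sub_le hΩ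
  have hint := (hC' s s.1.2).1
  have hsub : (Ω \ vortexCores a δ : Set Plane) ⊆ Ω := sdiff_subset
  have hmeas : MeasurableSet (Ω \ vortexCores a δ : Set Plane) :=
    Ω.isOpen.measurableSet.diff (isOpen_vortexCores a δ).measurableSet
  have hb : ∀ᵐ x ∂volume.restrict (Ω \ vortexCores a δ : Set Plane),
      ‖a s ^ 2 • rowField i s x‖ ≤ |a s| * δ⁻¹ * ‖x - s‖⁻¹ := by
    refine (ae_restrict_iff' hmeas).2 (ae_of_all _ fun x hx => ?_)
    rw [norm_smul, norm_pow, Real.norm_eq_abs]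
    rcases eq_or_ne (a s) 0 with h0 | h0
    · simp [h0]
    · have h1 : δ * |a s| ≤ ‖x - s‖ := by
        by_contra hcon
        refine hx.2 ⟨hx.1, mem_iUnion.2 ⟨s, ?_⟩⟩
        rw [Metric.mem_ball, dist_eq_norm]
        exact not_le.1 hcon
      have h2 : 0 < |a s| := abs_pos.2 h0
      have h3 : 0 < δ * |a s| := by positivity
      calc |a s| ^ 2 * ‖rowField i s x‖ ≤ |a s| ^ 2 * ‖x - s‖⁻¹ ^ 2 := by
            gcongr
            exact norm_rowField_le i s x
        _ = |a s| ^ 2 * ‖x - s‖⁻¹ * ‖x - s‖⁻¹ := by ring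
        _ ≤ |a s| ^ 2 * (δ * |a s|)⁻¹ * ‖x - s‖⁻¹ := by gcongr
        _ = |a s| * δ⁻¹ * ‖x - s‖⁻¹ := by field_simp
  have hI : IntegrableOn (fun x => a s ^ 2 • rowField i s x) (Ω \ vortexCores a δ) :=
    Integrable.mono' ((hint.mono_set hsub).const_mul _)
      ((measurable_rowField i s).const_smul (a s ^ 2)).aestronglyMeasurable hb
  refine ⟨hI, fun C hC => ?_⟩
  calc ∫ x in (Ω \ vortexCores a δ : Set Plane), ‖a s ^ 2 • rowField i s x‖
      ≤ ∫ x in (Ω \ vortexCores a δ : Set Plane), |a s| * δ⁻¹ * ‖x - s‖⁻¹ :=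
        integral_mono_ae hI.norm ((hint.mono_set hsub).const_mul _) hb
    _ = |a s| * δ⁻¹ * ∫ x in (Ω \ vortexCores a δ : Set Plane), ‖x - s‖⁻¹ :=
        integral_const_mul _ _
    _ ≤ |a s| * δ⁻¹ * ∫ x in (Ω : Set Plane), ‖x - s‖⁻¹ := by
        exact mul_le_mul_of_nonneg_left (setIntegral_mono_set hint
          (ae_of_all _ fun x => by positivity) hsub.eventuallyLE) (by positivity)
    _ ≤ |a s| * δ⁻¹ * C := by gcongr
    _ = |a s| * (δ⁻¹ * C) := mul_assoc _ _ _

/-- Each vortex contributes zero to the flux of the stress-energy tensor away from the cores. -/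
theorem setIntegral_inner_rowField_diff_eq_zero (a : S → ℝ) {δ : ℝ} (hδ : 0 < δ) (i : Fin 2)
    (ζ : 𝓓(Ω, ℝ)) (s : S) (hs : a s ≠ 0) :
    ∫ x in (Ω \ (ζ ⁻¹' (ζ '' vortexCores a δ)) : Set Plane),
      inner ℝ (rowField i s x) (gradient ζ x) = 0 := by
  have hζ := contDiff_testFunction ζ 1
  -- A nonzero weight gives a disc of positive radius, so the open core contains a ball about `s`,
  -- and the preimage of the complement of `ζ '' vortexCores a δ` avoids that ball.
  have hmem : (s : Plane) ∈ vortexCores a δ :=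
    ⟨s.1.2, mem_iUnion.2 ⟨s, Metric.mem_ball_self (by positivity)⟩⟩
  obtain ⟨ρ, hρ, hball⟩ := Metric.isOpen_iff.1 (isOpen_vortexCores a δ) _ hmem
  have hD : MeasurableSet (ζ '' vortexCores a δ)ᶜ :=
    (measurableSet_image_of_isOpen (isOpen_vortexCores a δ) hζ.continuous).compl
  have h := setIntegral_inner_rowField_eq_zero i (s : Plane) hρ hζ ζ.hasCompactSupport hD
    fun x hx => not_not.2 (mem_image_of_mem ζ (hball hx))
  rw [← h]
  -- The two domains differ only outside `Ω`, where `∇ζ` vanishes.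
  refine (setIntegral_eq_of_subset_of_forall_sdiff_eq_zero (hζ.continuous.measurable hD)
    (fun x hx => hx.2) fun x hx => ?_).symm
  have hx' : x ∉ Ω := fun h => hx.2 ⟨h, hx.1⟩
  rw [gradient_eq_zero_of_notMem fun h => hx' (ζ.tsupport_subset h), inner_zero_right]

theorem tendsto_oneCapacity_vortexCores (hS : S.Countable) {a : S → ℝ}
    (ha : Summable fun s => |a s|) (K : Set Plane) :
    Tendsto (fun δ => oneCapacity (K ∩ vortexCores a δ)) (𝓝[>] (0 : ℝ)) (𝓝 0) := by
  have : Countable S := hS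
  obtain ⟨C, hC0, hC⟩ := exists_oneCapacity_iUnion_ball_le
  have hlim : Tendsto (fun δ : ℝ => ENNReal.ofReal (C * (δ * ∑' s, |a s|))) (𝓝[>] (0 : ℝ))
      (𝓝 0) := by
    have h1 : Continuous fun δ : ℝ => ENNReal.ofReal (C * (δ * ∑' s, |a s|)) :=
      ENNReal.continuous_ofReal.comp (by fun_prop)
    have h2 := h1.tendsto 0
    simp only [zero_mul, mul_zero, ENNReal.ofReal_zero] at h2
    exact h2.mono_left nhdsWithin_le_nhds
  refine tendsto_of_tendsto_of_tendsto_of_le_of_le' tendsto_const_nhds hlim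
    (Eventually.of_forall fun _ => zero_le) ?_
  filter_upwards [self_mem_nhdsWithin] with δ hδ
  have hδ0 : (0 : ℝ) < δ := hδ
  refine (oneCapacity_mono fun x hx => hx.2.2).trans ?_
  rw [← tsum_mul_left]
  exact hC (fun s : S => (s : Plane)) (fun s => δ * |a s|) (fun s => by positivity)
    (ha.mul_left δ)

/-- If the Hopf differential of the potential has only double poles, then the stress-energy tensor
is divergence-free in finite part. -/
theorem isTensorDivFreeFP_potentialGrad (hΩ : Bornology.IsBounded (Ω : Set Plane))
    (hS : S.Countable) {a : S → ℝ} (ha : Summable fun s => |a s|)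
    (h : ∀ᵐ x ∂volume.restrict (Ω : Set Plane),
      (Summable fun s : S => (a s : ℂ) / (toC x - toC s)) ∧
      (∑' s : S, (a s : ℂ) / (toC x - toC s)) ^ 2 =
        ∑' s : S, (a s : ℂ) ^ 2 / (toC x - toC s) ^ 2) :
    IsTensorDivFreeFP Ω (fun x => stressEnergy (potentialGrad a x)) := by
  have : Countable S := hS
  intro i
  obtain ⟨C, hC0, hC⟩ := exists_integral_inv_norm_sub_le hΩ
  have hrow := ae_tensorRow_eq hΩ hS ha h i
  have hsum : ∀ δ > 0, ∀ A ⊆ (Ω \ vortexCores a δ : Set Plane),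
      Summable fun s : S => ∫ x in A, ‖a s ^ 2 • rowField i s x‖ := by
    intro δ hδ A hA
    refine Summable.of_nonneg_of_le (fun s => integral_nonneg fun _ => norm_nonneg _) (fun s => ?_)
      (ha.mul_right (δ⁻¹ * C))
    obtain ⟨h1, h2⟩ := integrableOn_smul_rowField hΩ a hδ i s
    exact (setIntegral_mono_set h1.norm (ae_of_all _ fun x => norm_nonneg _)
      hA.eventuallyLE).trans (h2 C (hC s s.1.2).2)
  refine ⟨vortexCores a, fun δ _ =>
    ⟨(isOpen_vortexCores a δ).measurableSet, inter_subset_left⟩,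
    fun K _ _ => tendsto_oneCapacity_vortexCores hS ha K, fun δ hδ => ?_, fun δ hδ ζ => ?_⟩
  · have h1 : Integrable (fun x => ∑' s : S, a s ^ 2 • rowField i s x)
        (volume.restrict (Ω \ vortexCores a δ : Set Plane)) :=
      integrable_tsum (fun s => (integrableOn_smul_rowField hΩ a hδ i s).1)
        (hsum δ hδ _ subset_rfl)
    refine h1.congr ?_
    filter_upwards [ae_restrict_of_ae_restrict_of_subset sdiff_subset hrow] with x hx
    exact hx.symm
  · have hζ := contDiff_testFunction ζ 1
    have hsub : (Ω \ (ζ ⁻¹' (ζ '' vortexCores a δ)) : Set Plane) ⊆ Ω \ vortexCores a δ :=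
      sdiff_subset_sdiff_right (subset_preimage_image _ _)
    obtain ⟨M, hM⟩ := (hasCompactSupport_gradient ζ.hasCompactSupport).exists_bound_of_continuous
      (continuous_gradient hζ)
    have hT : Continuous fun x => innerSL ℝ (gradient ζ x) :=
      (innerSL ℝ).continuous.comp (continuous_gradient hζ)
    have h1 := hasSum_integral_clm_apply
      (ν := volume.restrict (Ω \ (ζ ⁻¹' (ζ '' vortexCores a δ)) : Set Plane))
      (F := fun (s : S) x => a s ^ 2 • rowField i s x)
      (fun s => ((integrableOn_smul_rowField hΩ a hδ i s).1).mono_set hsub)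
      (hsum δ hδ _ hsub) hT.aestronglyMeasurable (M := M)
      (fun x => by
        rw [innerSL_apply_norm]
        exact hM x)
    have h2 : ∀ s : S, ∫ x in (Ω \ (ζ ⁻¹' (ζ '' vortexCores a δ)) : Set Plane),
        innerSL ℝ (gradient ζ x) (a s ^ 2 • rowField i s x) = 0 := by
      intro s
      rcases eq_or_ne (a s) 0 with h0 | h0
      · simp [h0]
      · have h3 := setIntegral_inner_rowField_diff_eq_zero a hδ i ζ s h0
        simp_rw [innerSL_apply_apply, inner_smul_right, real_inner_comm (rowField i s _)]
        rw [integral_const_mul, h3, mul_zero]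
    simp_rw [h2] at h1
    rw [hasSum_zero.unique h1]
    refine integral_congr_ae ?_
    filter_upwards [ae_restrict_of_ae_restrict_of_subset sdiff_subset hrow] with x hx
    rw [hx, innerSL_apply_apply, real_inner_comm]

end Assembly

/-! ### Points have zero `H¹`-capacity, so atoms are excluded from `H⁻¹`. -/

section NegativeSobolev

/-- Used pointwise for gradients of cutoffs living on disjoint annuli, so that their Dirichlet
energies add without cross terms. -/
theorem norm_sum_sq_of_subsingleton_support {ι E : Type*} [SeminormedAddCommGroup E]
    {T : Finset ι} {v : ι → E} (h : ∀ i ∈ T, ∀ j ∈ T, v i ≠ 0 → v j ≠ 0 → i = j) :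
    ‖∑ i ∈ T, v i‖ ^ 2 = ∑ i ∈ T, ‖v i‖ ^ 2 := by
  by_cases h0 : ∃ i ∈ T, v i ≠ 0
  · obtain ⟨i, hi, hvi⟩ := h0
    have hz : ∀ j ∈ T, j ≠ i → v j = 0 := fun j hj hji => by
      by_contra hcon
      exact hji (h j hj i hi hcon hvi)
    rw [Finset.sum_eq_single_of_mem i hi hz, Finset.sum_eq_single_of_mem i hi fun j hj hji => by
      rw [hz j hj hji]
      simp]
  · push Not at h0
    rw [Finset.sum_eq_zero h0, Finset.sum_eq_zero fun j hj => by
      rw [h0 j hj]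
      simp]
    simp

/-- The standard cutoff function of the unit disc. -/
def unitBump : ContDiffBump (0 : Plane) := ⟨1, 2, one_pos, one_lt_two⟩

/-- Its rescaling to the disc of centre `p` and radius `r`. -/
def discBump (p : Plane) (r : ℝ) (x : Plane) : ℝ := unitBump (r⁻¹ • (x - p))

theorem contDiff_discBump (p : Plane) (r : ℝ) (n : ℕ∞) : ContDiff ℝ n (discBump p r) :=
  unitBump.contDiff.comp ((contDiff_id.sub contDiff_const).const_smul r⁻¹)

theorem contDiff_one_discBump (p : Plane) (r : ℝ) : ContDiff ℝ 1 (discBump p r) :=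
  mod_cast contDiff_discBump p r 1

theorem discBump_nonneg (p : Plane) (r : ℝ) (x : Plane) : 0 ≤ discBump p r x :=
  unitBump.nonneg

theorem discBump_le_one (p : Plane) (r : ℝ) (x : Plane) : discBump p r x ≤ 1 :=
  unitBump.le_one

theorem discBump_self (p : Plane) (r : ℝ) : discBump p r p = 1 := by
  rw [discBump, sub_self, smul_zero]
  exact unitBump.one_of_mem_closedBall (by simp [unitBump])

theorem norm_inv_smul_sub {r : ℝ} (hr : 0 < r) (p x : Plane) :
    ‖r⁻¹ • (x - p)‖ = r⁻¹ * dist x p := by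
  rw [norm_smul, norm_inv, Real.norm_of_nonneg hr.le, dist_eq_norm]

theorem discBump_eq_zero {p : Plane} {r : ℝ} (hr : 0 < r) {x : Plane} (hx : 2 * r ≤ dist x p) :
    discBump p r x = 0 := by
  refine unitBump.zero_of_le_dist ?_
  rw [dist_zero_right, norm_inv_smul_sub hr]
  change 2 ≤ r⁻¹ * dist x p
  rw [le_inv_mul_iff₀ hr]
  linarith

theorem tsupport_discBump_subset (p : Plane) {r : ℝ} (hr : 0 < r) :
    tsupport (discBump p r) ⊆ Metric.closedBall p (2 * r) := by
  refine closure_minimal (fun x hx => ?_) Metric.isClosed_closedBall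
  by_contra hcon
  rw [Metric.mem_closedBall, not_le] at hcon
  exact hx (discBump_eq_zero hr hcon.le)

theorem hasCompactSupport_discBump (p : Plane) {r : ℝ} (hr : 0 < r) :
    HasCompactSupport (discBump p r) :=
  (isCompact_closedBall p (2 * r)).of_isClosed_subset (isClosed_tsupport _)
    (tsupport_discBump_subset p hr)

theorem dist_mem_Icc_of_gradient_discBump_ne_zero {p : Plane} {r : ℝ} (hr : 0 < r) {x : Plane}
    (h : gradient (discBump p r) x ≠ 0) : r ≤ dist x p ∧ dist x p ≤ 2 * r := by
  constructor
  · by_contra hcon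
    refine h ?_
    have h1 : discBump p r =ᶠ[𝓝 x] fun _ => 1 := by
      filter_upwards [Metric.isOpen_ball.mem_nhds (Metric.mem_ball.2 (not_le.1 hcon))] with y hy
      refine unitBump.one_of_mem_closedBall ?_
      rw [mem_closedBall_zero_iff, norm_inv_smul_sub hr]
      change r⁻¹ * dist y p ≤ 1
      rw [inv_mul_le_one₀ hr]
      exact (Metric.mem_ball.1 hy).le
    rw [h1.gradient_eq, gradient_fun_const]
  · by_contra hcon
    exact h (gradient_eq_zero_of_notMem fun hx =>
      hcon (Metric.mem_closedBall.1 (tsupport_discBump_subset p hr hx)))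

theorem integral_discBump (p : Plane) (r : ℝ) :
    ∫ x, discBump p r x = r ^ 2 * ∫ x, unitBump x :=
  integral_comp_inv_smul_sub unitBump p r

/-- The Dirichlet integral is scale invariant in dimension two: `r⁻²` from the gradient cancels `r²`
from the area. -/
theorem integral_norm_gradient_discBump_sq (p : Plane) {r : ℝ} (hr : 0 < r) :
    ∫ x, ‖gradient (discBump p r) x‖ ^ 2 = ∫ x, ‖gradient unitBump x‖ ^ 2 := by
  have h1 : ∀ x, gradient (discBump p r) x = r⁻¹ • gradient unitBump (r⁻¹ • (x - p)) := fun x =>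
    gradient_comp_inv_smul_sub ((unitBump.contDiff (n := 1)).differentiable one_ne_zero) p r x
  simp_rw [h1, norm_smul, mul_pow]
  rw [integral_const_mul, integral_comp_inv_smul_sub (fun y => ‖gradient unitBump y‖ ^ 2) p r,
    norm_inv, Real.norm_of_nonneg hr.le]
  field_simp

/-- The average of the cutoff functions of the discs of centre `p` and radii `r / 4 ^ j`, `j < m`. -/
def avgBump (p : Plane) (r : ℝ) (m : ℕ) (x : Plane) : ℝ :=
  (m : ℝ)⁻¹ * ∑ j ∈ Finset.range m, discBump p (r / 4 ^ j) x

theorem contDiff_avgBump (p : Plane) (r : ℝ) (m : ℕ) (n : ℕ∞) : ContDiff ℝ n (avgBump p r m) :=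
  contDiff_const.mul (ContDiff.sum fun _ _ => contDiff_discBump p _ n)

theorem continuous_avgBump (p : Plane) (r : ℝ) (m : ℕ) : Continuous (avgBump p r m) :=
  continuous_const.mul (continuous_finsetSum _ fun _ _ => (contDiff_one_discBump p _).continuous)

theorem avgBump_nonneg (p : Plane) (r : ℝ) (m : ℕ) (x : Plane) : 0 ≤ avgBump p r m x :=
  mul_nonneg (by positivity) (Finset.sum_nonneg fun _ _ => discBump_nonneg _ _ _)

theorem avgBump_le_one (p : Plane) (r : ℝ) (m : ℕ) (x : Plane) : avgBump p r m x ≤ 1 := by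
  have h1 : ∑ j ∈ Finset.range m, discBump p (r / 4 ^ j) x ≤ ∑ j ∈ Finset.range m, (1 : ℝ) :=
    Finset.sum_le_sum fun _ _ => discBump_le_one _ _ _
  rw [Finset.sum_const, Finset.card_range, nsmul_eq_mul, mul_one] at h1
  exact inv_mul_le_one_of_le₀ h1 (Nat.cast_nonneg m)

theorem tendsto_avgBump_self (p : Plane) (r : ℝ) :
    Tendsto (fun m => avgBump p r m p) atTop (𝓝 1) := by
  have h1 : Tendsto (fun _ : ℕ => (1 : ℝ)) atTop (𝓝 1) := tendsto_const_nhds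
  have h2 := h1.cesaro
  simpa only [avgBump, discBump_self] using h2

theorem tendsto_avgBump_of_ne {p : Plane} {r : ℝ} (hr : 0 < r) {x : Plane} (hx : x ≠ p) :
    Tendsto (fun m => avgBump p r m x) atTop (𝓝 0) := by
  have h1 : Tendsto (fun j : ℕ => discBump p (r / 4 ^ j) x) atTop (𝓝 0) := by
    have h2 : Tendsto (fun j : ℕ => 2 * (r / 4 ^ j)) atTop (𝓝 (2 * 0)) :=
      ((tendsto_const_nhds (x := r)).div_atTop
        (tendsto_pow_atTop_atTop_of_one_lt (by norm_num))).const_mul 2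
    rw [mul_zero] at h2
    refine tendsto_const_nhds.congr' ?_
    filter_upwards [h2.eventually (gt_mem_nhds (dist_pos.2 hx))] with j hj
    exact (discBump_eq_zero (by positivity) hj.le).symm
  exact h1.cesaro

theorem tsupport_avgBump_subset (p : Plane) {r : ℝ} (hr : 0 < r) (m : ℕ) :
    tsupport (avgBump p r m) ⊆ Metric.closedBall p (2 * r) := by
  refine closure_minimal (fun x hx => ?_) Metric.isClosed_closedBall
  by_contra hcon
  rw [Metric.mem_closedBall, not_le] at hcon
  refine hx ?_
  rw [avgBump, Finset.sum_eq_zero fun j _ => ?_, mul_zero]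
  refine discBump_eq_zero (by positivity) (le_trans ?_ hcon.le)
  have : r / 4 ^ j ≤ r := div_le_self hr.le (one_le_pow₀ (by norm_num))
  linarith

theorem hasCompactSupport_avgBump (p : Plane) {r : ℝ} (hr : 0 < r) (m : ℕ) :
    HasCompactSupport (avgBump p r m) :=
  (isCompact_closedBall p (2 * r)).of_isClosed_subset (isClosed_tsupport _)
    (tsupport_avgBump_subset p hr m)

theorem integrable_sq_of_hasCompactSupport {f : Plane → ℝ} (hf : Continuous f)
    (hc : HasCompactSupport f) : Integrable fun x => f x ^ 2 := by
  have h1 : Continuous fun x => f x ^ 2 := hf.pow 2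
  exact h1.integrable_of_hasCompactSupport <| HasCompactSupport.intro hc fun x hx => by
    rw [image_eq_zero_of_notMem_tsupport hx, zero_pow two_ne_zero]

theorem integrable_norm_sq_of_hasCompactSupport {f : Plane → Plane} (hf : Continuous f)
    (hc : HasCompactSupport f) : Integrable fun x => ‖f x‖ ^ 2 :=
  integrable_sq_of_hasCompactSupport hf.norm hc.norm

/-- Values lie in `[0, 1]`, so the square is at most the function itself; the disc areas then form a
geometric series of ratio `1 / 16`, with sum at most `2`. -/
theorem integral_avgBump_sq_le (p : Plane) {r : ℝ} (hr : 0 < r) (m : ℕ) :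
    ∫ x, avgBump p r m x ^ 2 ≤ (m : ℝ)⁻¹ * (r ^ 2 * 2 * ∫ x, unitBump x) := by
  have hB : 0 ≤ ∫ x, unitBump x := integral_nonneg fun _ => unitBump.nonneg
  have hd : ∀ j : ℕ, Integrable (discBump p (r / 4 ^ j)) := fun j =>
    (contDiff_one_discBump p _).continuous.integrable_of_hasCompactSupport
      (hasCompactSupport_discBump p (by positivity))
  have hcont : Continuous (avgBump p r m) := continuous_avgBump p r m
  have hc := hasCompactSupport_avgBump p hr m
  have h1 : ∫ x, avgBump p r m x ^ 2 ≤ ∫ x, avgBump p r m x := by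
    refine integral_mono ?_ (hcont.integrable_of_hasCompactSupport hc) fun x => ?_
    · exact integrable_sq_of_hasCompactSupport hcont hc
    · simp only
      nlinarith [avgBump_nonneg p r m x, avgBump_le_one p r m x]
  refine h1.trans ?_
  simp only [avgBump]
  rw [integral_const_mul, integral_finsetSum _ fun j _ => hd j]
  simp_rw [integral_discBump]
  rw [← Finset.sum_mul]
  refine mul_le_mul_of_nonneg_left (mul_le_mul_of_nonneg_right ?_ hB) (by positivity)
  have h2 : ∀ j : ℕ, (r / 4 ^ j) ^ 2 = r ^ 2 * (1 / 16) ^ j := fun j => by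
    rw [div_pow, ← pow_mul, mul_comm j, pow_mul, one_div, inv_pow, div_eq_mul_inv]
    norm_num
  simp_rw [h2]
  rw [← Finset.mul_sum]
  refine mul_le_mul_of_nonneg_left ?_ (sq_nonneg r)
  refine ((summable_geometric_of_lt_one (by norm_num) (by norm_num)).sum_le_tsum _
    fun j _ => by positivity).trans ?_
  rw [tsum_geometric_of_lt_one (by norm_num) (by norm_num)]
  norm_num

theorem gradient_avgBump (p : Plane) (r : ℝ) (m : ℕ) (x : Plane) :
    gradient (avgBump p r m) x =
      (m : ℝ)⁻¹ • ∑ j ∈ Finset.range m, gradient (discBump p (r / 4 ^ j)) x := by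
  have hd : ∀ j ∈ Finset.range m, DifferentiableAt ℝ (discBump p (r / 4 ^ j)) x := fun j _ =>
    (contDiff_one_discBump p _).differentiable one_ne_zero x
  have h1 : fderiv ℝ (avgBump p r m) x =
      (m : ℝ)⁻¹ • ∑ j ∈ Finset.range m, fderiv ℝ (discBump p (r / 4 ^ j)) x := by
    rw [← fderiv_fun_sum hd]
    exact fderiv_const_mul (DifferentiableAt.fun_sum hd) _
  simp only [gradient]
  rw [h1, map_smul, map_sum]

/-- The gradients live in the annuli `r / 4 ^ j ≤ |x - p| ≤ 2 r / 4 ^ j`, disjoint thanks to the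
ratio `4`. The `m` equal energies add up, and the prefactor `m⁻²` leaves `m⁻¹`. -/
theorem integral_norm_gradient_avgBump_sq (p : Plane) {r : ℝ} (hr : 0 < r) (m : ℕ) :
    ∫ x, ‖gradient (avgBump p r m) x‖ ^ 2 = (m : ℝ)⁻¹ * ∫ x, ‖gradient unitBump x‖ ^ 2 := by
  have hint : ∀ j : ℕ, Integrable fun x => ‖gradient (discBump p (r / 4 ^ j)) x‖ ^ 2 := fun j =>
    integrable_norm_sq_of_hasCompactSupport
      (continuous_gradient (contDiff_one_discBump p (r / 4 ^ j)))
      (hasCompactSupport_gradient (hasCompactSupport_discBump p (by positivity)))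
  have h1 : ∀ x, ‖gradient (avgBump p r m) x‖ ^ 2 =
      (m : ℝ)⁻¹ ^ 2 * ∑ j ∈ Finset.range m, ‖gradient (discBump p (r / 4 ^ j)) x‖ ^ 2 := by
    intro x
    rw [gradient_avgBump, norm_smul, mul_pow, norm_inv, Real.norm_natCast]
    congr 1
    refine norm_sum_sq_of_subsingleton_support fun i _ j _ hi hj => ?_
    have key : ∀ i j : ℕ, i < j → gradient (discBump p (r / 4 ^ i)) x ≠ 0 →
        gradient (discBump p (r / 4 ^ j)) x ≠ 0 → False := by
      intro i j hij hi hj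
      have h2 := (dist_mem_Icc_of_gradient_discBump_ne_zero (by positivity) hi).1
      have h3 := (dist_mem_Icc_of_gradient_discBump_ne_zero (by positivity) hj).2
      have h4 : (4 : ℝ) ^ (i + 1) ≤ 4 ^ j := pow_le_pow_right₀ (by norm_num) hij
      have h5 : r / 4 ^ j ≤ r / 4 ^ (i + 1) := by gcongr
      have h6 : r / 4 ^ (i + 1) = r / 4 ^ i / 4 := by
        rw [pow_succ]
        field_simp
      have h7 : 0 < r / 4 ^ i := by positivity
      linarith
    rcases lt_trichotomy i j with h | h | h
    · exact (key i j h hi hj).elim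
    · exact h
    · exact (key j i h hj hi).elim
  simp_rw [h1]
  rw [integral_const_mul, integral_finsetSum _ fun j _ => hint j]
  have h2 : ∀ j ∈ Finset.range m, ∫ x, ‖gradient (discBump p (r / 4 ^ j)) x‖ ^ 2 =
      ∫ x, ‖gradient unitBump x‖ ^ 2 := fun j _ =>
    integral_norm_gradient_discBump_sq p (by positivity)
  rw [Finset.sum_congr rfl h2, Finset.sum_const, Finset.card_range, nsmul_eq_mul, ← mul_assoc]
  congr 1
  rcases Nat.eq_zero_or_pos m with rfl | hm
  · simp
  · have : (m : ℝ) ≠ 0 := by positivity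
    field_simp

variable {Ω : Opens Plane} {S : Set Ω}

/-- An atomic measure in `H⁻¹` vanishes. -/
theorem IsHMinusOne.weights_eq_zero {a : S → ℝ} (ha : Summable fun s => |a s|)
    {μ : SignedMeasure Ω}
    (hμ : ∀ f : Ω →ᵇ ℝ, ∫ᵛ x, f x ∂•μ = 2 * Real.pi * ∑' s : S, a s * f s)
    (h : IsHMinusOne Ω μ) (s₀ : S) : a s₀ = 0 := by
  classical
  obtain ⟨C, hC⟩ := h
  obtain ⟨R, hR, hball⟩ := Metric.isOpen_iff.1 Ω.isOpen (s₀ : Plane) s₀.1.2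
  have hr : 0 < R / 4 := by positivity
  let p : Plane := s₀
  -- These test functions tend to zero in `H¹` yet converge boundedly to the indicator of `s₀`, so
  -- pairing with `μ` isolates `2π a s₀` and forces it to vanish. The radius `R / 4` puts the
  -- supports in the closed disc of radius `R / 2`, inside `Ω`.
  let φ : ℕ → 𝓓(Ω, ℝ) := fun m =>
    ⟨avgBump p (R / 4) m, contDiff_avgBump _ _ _ _, hasCompactSupport_avgBump _ hr _,
      (tsupport_avgBump_subset _ hr _).trans
        ((Metric.closedBall_subset_ball (by linarith)).trans hball)⟩
  have hφ : ∀ m x, φ m x = avgBump p (R / 4) m x := fun _ _ => rfl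
  let B := (R / 4) ^ 2 * 2 * (∫ x, unitBump x) + ∫ x, ‖gradient unitBump x‖ ^ 2
  have hnorm : ∀ m, testH1Norm (φ m) ≤ Real.sqrt ((m : ℝ)⁻¹ * B) := fun m => by
    refine Real.sqrt_le_sqrt ?_
    rw [mul_add]
    exact add_le_add (integral_avgBump_sq_le p hr m)
      (integral_norm_gradient_avgBump_sq p hr m).le
  have hnorm0 : Tendsto (fun m => testH1Norm (φ m)) atTop (𝓝 0) := by
    have h1 : Tendsto (fun m : ℕ => Real.sqrt ((m : ℝ)⁻¹ * B)) atTop (𝓝 (Real.sqrt (0 * B))) :=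
      ((tendsto_inv_atTop_nhds_zero_nat (𝕜 := ℝ)).mul_const B).sqrt
    rw [zero_mul, Real.sqrt_zero] at h1
    exact squeeze_zero (fun m => Real.sqrt_nonneg _) hnorm h1
  have hval : ∀ m, ∫ᵛ x : Ω, φ m (x : Plane) ∂•μ =
      2 * Real.pi * ∑' s : S, a s * φ m s := fun m => hμ (restrictTest (φ m))
  have hlim0 : Tendsto (fun m => 2 * Real.pi * ∑' s : S, a s * φ m s) atTop (𝓝 0) := by
    refine squeeze_zero_norm (fun m => ?_) (by simpa using hnorm0.const_mul C)
    rw [← hval]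
    exact hC (φ m)
  have hlim1 : Tendsto (fun m => ∑' s : S, a s * φ m s) atTop
      (𝓝 (∑' s : S, a s * if s = s₀ then 1 else 0)) := by
    refine tendsto_tsum_of_dominated_convergence ha (fun s => ?_) (Eventually.of_forall
      fun m s => ?_)
    · refine Tendsto.const_mul _ ?_
      simp only [hφ]
      split_ifs with hs
      · rw [hs]
        exact tendsto_avgBump_self p _
      · exact tendsto_avgBump_of_ne hr fun h => hs (Subtype.ext (Subtype.ext h))
    · rw [norm_mul, hφ, Real.norm_of_nonneg (avgBump_nonneg _ _ _ _)]
      exact mul_le_of_le_one_right (norm_nonneg _) (avgBump_le_one _ _ _ _)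
  have heq := tendsto_nhds_unique hlim0 (hlim1.const_mul (2 * Real.pi))
  simp only [mul_ite, mul_one, mul_zero, tsum_ite_eq] at heq
  exact (mul_eq_zero.1 heq.symm).resolve_left (by positivity)

end NegativeSobolev

/-! ### The trivial `H⁻¹` case and the conclusion. -/

theorem isH1With_zero (Ω : Opens Plane) : IsH1With Ω (fun _ => 0) (fun _ => 0) :=
  ⟨MemLp.zero, MemLp.zero, locallyIntegrableOn_zero, locallyIntegrableOn_zero, fun φ => by simp⟩

theorem isStationaryHarmonic_zero (Ω : Opens Plane) : IsStationaryHarmonic Ω fun _ => 0 := by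
  refine ⟨fun _ => 0, isH1With_zero Ω, fun i => ?_⟩
  have h : tensorRow (fun _ => stressEnergy (0 : Plane)) i = fun _ => 0 := by
    funext x
    fin_cases i <;> ext j <;> fin_cases j <;> simp [tensorRow, stressEnergy]
  simp only [h]
  exact ⟨locallyIntegrableOn_zero, fun ζ => by simp⟩

end PointVortex

end

theorem theorem5 (Ω : TopologicalSpace.Opens PointVortex.Plane)
    (hΩ : Bornology.IsBounded (Ω : Set PointVortex.Plane))
    (μ : MeasureTheory.SignedMeasure Ω)
    (hμ : PointVortex.IsLimitOfStationaryVortices μ) :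
    ∃ u : PointVortex.Plane → ℝ,
      MeasureTheory.LocallyIntegrableOn u Ω MeasureTheory.volume ∧
      PointVortex.HasWeakLaplacian Ω u μ ∧
      PointVortex.IsWeaklyStationaryHarmonic Ω u ∧
      (PointVortex.IsHMinusOne Ω μ →
        PointVortex.IsH1 Ω u ∧ PointVortex.IsStationaryHarmonic Ω u) := by
  obtain ⟨S, α, a, hS, ha, hα, hαa, hsq, hint⟩ := hμ.exists_weights
  have hgrad := PointVortex.hasWeakGradient_potential hΩ hS ha
  refine ⟨PointVortex.potential a, hgrad.locallyIntegrableOn,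
    PointVortex.hasWeakLaplacian_potential hΩ hS ha hint,
    ⟨PointVortex.potentialGrad a, hgrad, PointVortex.isTensorDivFreeFP_potentialGrad hΩ hS ha
      (PointVortex.ae_sq_tsum_eq hΩ hS ha hα hαa hsq)⟩, fun h => ?_⟩
  -- All weights vanish, so the potential already chosen is identically zero and its stationarity is
  -- trivial.
  have h0 : PointVortex.potential a = fun _ => 0 := by
    funext x
    simp [PointVortex.potential, h.weights_eq_zero ha hint]
  rw [h0]
  exact ⟨⟨_, PointVortex.isH1With_zero Ω⟩, PointVortex.isStationaryHarmonic_zero Ω⟩
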